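/- Theorem. The random Apollonian network is built as follows. Start with a triangle embedded in the plane; in each step choose a bounded face uniformly at random, add a new vertex inside it and join the new vertex to the three vertices of that face, so that the face is subdivided into three new bounded faces. The triangle-tree $\mathcal T_t$ of the network after $t$ steps is the rooted tree whose vertices are the triangles of the network (the initial triangle and all triangles that have arisen by subdivision), whose root is the initial triangle, and in which the offspring of a subdivided triangle are the three triangles into which it was subdivided; thus $\mathcal T_t$ has $3t+1$ vertices. The grand-offspring of a vertex are the offspring of its offspring. A (finite) subtree, i.e. connected subgraph, $J$ of $\mathcal T_t$ is called buono if each vertex of $J$ has at most eight grand-offspring in $J$. Let $(A_1,A_2,A_3)$, $(B_1,B_2,B_3)$, $(B_4,B_5,B_6)$, $(B_7,B_8,B_9)$ be independent random vectors, each with the Dirichlet$(1/2,1/2,1/2)$ distribution, and let $$\Upsilon=\min\{A_iB_j : 1\le i\le 3,\ 1\le j\le 9\}.$$ Let $\tau>1$, $\kappa>0$ and $\lambda>0$ be constants satisfying $$3e\log\tau<2\sqrt{\tau}\qquad\text{and}\qquad 9\,\kappa^{\lambda}\,\mathbf E\big[(1-\Upsilon)^{\lambda}\big]<1,$$ and for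 each $t$ let $n=n(t)$ be the largest even integer smaller than $\log t/\log\tau$. Then there exists a constant $K$, depending only on $\tau,\kappa,\lambda$, such that almost surely, for all sufficiently large $t$ (how large may depend on the realization), every buono subtree of $\mathcal T_t$ has at most $$K\left(8^{n/2}+t\,\kappa^{-n/2}\right)$$ vertices. -/

import Mathlib

open MeasureTheory ProbabilityTheory Filter

namespace RAN

noncomputable section

/-! ### The Dirichlet distribution and the variable `Υ` -/

/-- The density of the Dirichlet distribution with parameters `α 0, …, α n`, as a function of the
first `n` coordinates `x` of the point `(x, 1 - ∑ x)` of the simplex. -/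
def dirichletDensity {n : ℕ} (α : Fin (n + 1) → ℝ) (x : Fin n → ℝ) : ℝ :=
  open scoped Classical in
  if (∀ i, 0 < x i) ∧ ∑ i, x i < 1 then
    Real.Gamma (∑ i, α i) / (∏ i, Real.Gamma (α i)) *
      ∏ j, (Fin.snoc x (1 - ∑ i, x i) : Fin (n + 1) → ℝ) j ^ (α j - 1)
  else 0

/-- The Dirichlet distribution with parameters `α 0, …, α n`, a measure on `ℝ^(n+1)` carried by
the standard simplex. The reference measure on the simplex is the Lebesgue measure in the first `n`
coordinates. -/
def dirichlet {n : ℕ} (α : Fin (n + 1) → ℝ) : Measure (Fin (n + 1) → ℝ) :=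
  ((volume : Measure (Fin n → ℝ)).withDensity
      fun x => ENNReal.ofReal (dirichletDensity α x)).map
    fun x => Fin.snoc x (1 - ∑ i, x i)

/-- `Υ = min {A_i B_j : 1 ≤ i ≤ 3, 1 ≤ j ≤ 9}`, where `A = v 0` and where `(B_1, B_2, B_3)`,
`(B_4, B_5, B_6)`, `(B_7, B_8, B_9)` are `v 1`, `v 2`, `v 3`. -/
def upsilon (v : Fin 4 → Fin 3 → ℝ) : ℝ :=
  (Finset.univ : Finset (Fin 3 × Fin 3 × Fin 3)).inf' Finset.univ_nonempty
    fun p => v 0 p.1 * v p.2.1.succ p.2.2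

/-- The joint law of four independent Dirichlet(1/2, 1/2, 1/2) vectors. -/
def fourDirichlet : Measure (Fin 4 → Fin 3 → ℝ) :=
  Measure.pi fun _ => dirichlet (n := 2) fun _ => 1 / 2

/-! ### Random Apollonian networks

A triangle is given by the set of its three corners. The vertices are labelled by natural numbers:
the initial triangle is `{0, 1, 2}`, and the vertex added in step `s` (`s = 0, 1, 2, …`) is `s + 3`.
A sequence `f : ℕ → Finset ℕ` records the successive choices: `f s` is the bounded face that is
subdivided in step `s`. The network after `t` steps depends only on `f 0, …, f (t - 1)`. -/

/-- The three triangles into which the triangle `T` is subdivided by the new vertex `v`: each of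
them arises by replacing one corner of `T` by `v`. -/
def subdivide (v : ℕ) (T : Finset ℕ) : Finset (Finset ℕ) :=
  T.image fun a => insert v (T.erase a)

/-- The bounded faces of the network after `t` steps. -/
def boundedFaces (f : ℕ → Finset ℕ) : ℕ → Finset (Finset ℕ)
  | 0 => {{0, 1, 2}}
  | t + 1 => (boundedFaces f t).erase (f t) ∪ subdivide (t + 3) (f t)

/-- All triangles of the network after `t` steps: the bounded faces, and the triangles that were
bounded faces earlier and have been subdivided. -/
def triangles (f : ℕ → Finset ℕ) : ℕ → Finset (Finset ℕ)
  | 0 => {{0, 1, 2}}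
  | t + 1 => triangles f t ∪ subdivide (t + 3) (f t)

/-- The random Apollonian network: in each step a bounded face is chosen uniformly at random, given
the past, and is subdivided. Here `F s ω` is the face chosen in step `s`. -/
structure IsRandomApollonianNetwork {Ω : Type*} [MeasurableSpace Ω] (P : Measure Ω)
    (F : ℕ → Ω → Finset ℕ) : Prop where
  measurableSet_eq : ∀ (t : ℕ) (T : Finset ℕ), MeasurableSet {ω | F t ω = T}
  cond_uniform : ∀ (t : ℕ) (f : ℕ → Finset ℕ), P {ω | ∀ s < t, F s ω = f s} ≠ 0 →
    ∀ T ∈ boundedFaces f t,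
      ProbabilityTheory.cond P {ω | ∀ s < t, F s ω = f s} {ω | F t ω = T}
        = ((boundedFaces f t).card : ENNReal)⁻¹

/-! ### The triangle-tree

Its vertices are the triangles of the network, its root is the initial triangle, and the offspring
of a triangle are the three triangles into which it was subdivided. -/

/-- `T'` is one of the offspring of `T` in the triangle-tree after `t` steps. -/
def IsOffspring (f : ℕ → Finset ℕ) (t : ℕ) (T T' : Finset ℕ) : Prop :=
  ∃ s < t, f s = T ∧ T' ∈ subdivide (s + 3) T

/-- `T''` is an offspring of an offspring of `T` in the triangle-tree after `t` steps. -/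
def IsGrandOffspring (f : ℕ → Finset ℕ) (t : ℕ) (T T'' : Finset ℕ) : Prop :=
  ∃ T', IsOffspring f t T T' ∧ IsOffspring f t T' T''

/-- The triangle-tree after `t` steps, as a graph (its vertex set is `triangles f t`; all other
elements of the type are isolated). -/
def triangleTree (f : ℕ → Finset ℕ) (t : ℕ) : SimpleGraph (Finset ℕ) :=
  SimpleGraph.fromRel (IsOffspring f t)

/-- `J` is the vertex set of a subtree (a connected subgraph) of the triangle-tree after `t` steps
which is buono: each vertex of `J` has at most eight grand-offspring in `J`. -/
structure IsBuonoSubtree (f : ℕ → Finset ℕ) (t : ℕ) (J : Finset (Finset ℕ)) : Prop where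
  subset : J ⊆ triangles f t
  connected : ((triangleTree f t).induce (J : Set (Finset ℕ))).Connected
  buono : ∀ T ∈ J, {T'' | T'' ∈ J ∧ IsGrandOffspring f t T T''}.ncard ≤ 8

end

end RAN

namespace RAN

noncomputable section

/-! ### Admissible histories -/

/-! Below any vertex hang nine branches two levels down. A connected set that meets all nine
contains the vertex and its nine grand-offspring, so a buono subtree misses one of the nine
(`exists_disjoint_branch`). The missed branch is at least as large as the smallest, so descending
two levels turns one branch into eight whose total size is at most `ratio` times the old one. After
`k` double levels, with branches abandoned once they have fewer than `L` subdivisions, the subtree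
has order `8 ^ k` vertices plus three times the size times the `potential`, the largest product of
ratios along a path (`card_inter_labels_le_potential`).

The potential is controlled by a moment. Given the branch sizes, each branch is again a uniformly
grown tree; replacing the maximum over nine branches by a sum bounds the `lam`-th moment by `(9 * θ)
^ k`, where `θ` bounds the mean of `ratio ^ lam` for sizes at least `L` (`law_potential_le`).

The branch sizes follow Pólya urns, which are mixtures of independent draws with Dirichlet(1/2, 1/2,
1/2) colour probabilities (`urn_iterate_eq_integral`). By a second moment bound the nine shares are
close to products `A_i B_j`, each at least `Υ`; so every `θ` above the mean of `(1 - Υ) ^ lam` is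
admissible for large `L` (`exists_law_ratio_le`).

Markov's inequality and Borel–Cantelli bound the potential by `κ ^ (-k)` at the times `⌈τ ^ (2 * k +
2)⌉₊`. Each such time closes the block of all `t` with `n = 2 * k`; since a buono subtree stays
buono as the network grows (`IsBuonoSubtree.mono`), the bound there serves the whole block at the
cost of a constant factor. -/

/-- In each of the first `t` steps a bounded face is subdivided. -/
def Valid (f : ℕ → Finset ℕ) (t : ℕ) : Prop := ∀ s < t, f s ∈ boundedFaces f s

theorem Valid.mono {f : ℕ → Finset ℕ} {s t : ℕ} (h : Valid f t) (hst : s ≤ t) : Valid f s :=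
  fun r hr => h r (hr.trans_le hst)

theorem valid_succ {f : ℕ → Finset ℕ} {t : ℕ} :
    Valid f (t + 1) ↔ Valid f t ∧ f t ∈ boundedFaces f t := by
  refine ⟨fun h => ⟨h.mono (Nat.le_succ t), h t (Nat.lt_succ_self t)⟩, fun h s hs => ?_⟩
  rcases Nat.lt_succ_iff_lt_or_eq.1 hs with h' | rfl
  · exact h.1 s h'
  · exact h.2

theorem boundedFaces_congr {f g : ℕ → Finset ℕ} {t : ℕ} (h : ∀ s < t, f s = g s) :
    boundedFaces f t = boundedFaces g t := by
  induction t with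
  | zero => rfl
  | succ t ih =>
    simp only [boundedFaces, ih fun s hs => h s (hs.trans (Nat.lt_succ_self t)),
      h t (Nat.lt_succ_self t)]

theorem valid_congr {f g : ℕ → Finset ℕ} {t : ℕ} (h : ∀ s < t, f s = g s) :
    Valid f t ↔ Valid g t := by
  refine forall₂_congr fun s hs => ?_
  rw [h s hs, boundedFaces_congr fun r hr => h r (hr.trans hs)]

theorem mem_of_mem_subdivide {v : ℕ} {T T' : Finset ℕ} (h : T' ∈ subdivide v T) : v ∈ T' := by
  obtain ⟨a, -, rfl⟩ := Finset.mem_image.1 h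
  exact Finset.mem_insert_self _ _

theorem subset_of_mem_subdivide {v : ℕ} {T T' : Finset ℕ} (h : T' ∈ subdivide v T) :
    T' ⊆ insert v T := by
  obtain ⟨a, -, rfl⟩ := Finset.mem_image.1 h
  exact Finset.insert_subset_insert _ (Finset.erase_subset _ _)

theorem card_of_mem_subdivide {v : ℕ} {T T' : Finset ℕ} (hv : v ∉ T) (h : T' ∈ subdivide v T) :
    T'.card = T.card := by
  obtain ⟨a, ha, rfl⟩ := Finset.mem_image.1 h
  rw [Finset.card_insert_of_notMem (fun h' => hv (Finset.mem_of_mem_erase h')),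
    Finset.card_erase_add_one ha]

theorem card_subdivide {v : ℕ} {T : Finset ℕ} (hv : v ∉ T) :
    (subdivide v T).card = T.card := by
  refine Finset.card_image_of_injOn fun a ha b hb hab => ?_
  by_contra hne
  have : a ∈ insert v (T.erase b) :=
    Finset.mem_insert_of_mem (Finset.mem_erase.2 ⟨hne, ha⟩)
  rw [← show insert v (T.erase a) = insert v (T.erase b) from hab] at this
  rcases Finset.mem_insert.1 this with rfl | h
  · exact hv ha
  · exact Finset.notMem_erase a T h

theorem boundedFaces_subset_triangles (f : ℕ → Finset ℕ) (t : ℕ) :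
    boundedFaces f t ⊆ triangles f t := by
  induction t with
  | zero => exact subset_rfl
  | succ t ih =>
    exact Finset.union_subset_union ((Finset.erase_subset _ _).trans ih) subset_rfl

theorem triangles_mono {f : ℕ → Finset ℕ} {s t : ℕ} (h : s ≤ t) :
    triangles f s ⊆ triangles f t := by
  induction h with
  | refl => exact subset_rfl
  | step _ ih => exact ih.trans Finset.subset_union_left

/-- Corner labels record time: after `t` steps only labels below `t + 3` occur, so the next vertex
is fresh. All distinctness statements below rest on this. -/
theorem triangle_spec {f : ℕ → Finset ℕ} {t : ℕ} (hf : Valid f t) {T : Finset ℕ}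
    (hT : T ∈ triangles f t) : T ⊆ Finset.range (t + 3) ∧ T.card = 3 := by
  induction t generalizing T with
  | zero =>
    obtain rfl := Finset.mem_singleton.1 hT
    decide
  | succ t ih =>
    obtain ⟨hf, hft⟩ := valid_succ.1 hf
    have hsub : Finset.range (t + 3) ⊆ Finset.range (t + 1 + 3) := by
      simp only [Finset.range_subset_range]; omega
    rcases Finset.mem_union.1 hT with hT | hT
    · exact ⟨(ih hf hT).1.trans hsub, (ih hf hT).2⟩
    · have h := ih hf (boundedFaces_subset_triangles f t hft)
      have hv : t + 3 ∉ f t := fun h' => by simpa using h.1 h'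
      refine ⟨(subset_of_mem_subdivide hT).trans (Finset.insert_subset ?_ (h.1.trans hsub)), ?_⟩
      · simp only [Finset.mem_range]; omega
      · rw [card_of_mem_subdivide hv hT, h.2]

theorem Valid.face_spec {f : ℕ → Finset ℕ} {t s : ℕ} (hf : Valid f t) (hs : s < t) :
    f s ⊆ Finset.range (s + 3) ∧ (f s).card = 3 ∧ s + 3 ∉ f s := by
  have h := triangle_spec (hf.mono hs.le) (boundedFaces_subset_triangles f s (hf s hs))
  exact ⟨h.1, h.2, fun h' => by simpa using h.1 h'⟩

/-- A face once subdivided is erased and cannot reappear, because every later triangle has a corner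
newer than all of its corners. -/
theorem ne_of_mem_boundedFaces {f : ℕ → Finset ℕ} {t : ℕ} (hf : Valid f t) {T : Finset ℕ}
    (hT : T ∈ boundedFaces f t) {s : ℕ} (hs : s < t) : f s ≠ T := by
  induction t generalizing T with
  | zero => omega
  | succ t ih =>
    rintro rfl
    have h3 := (hf.face_spec hs).1
    obtain ⟨hf, hft⟩ := valid_succ.1 hf
    rcases Finset.mem_union.1 hT with hT | hT
    · obtain ⟨hne, hT⟩ := Finset.mem_erase.1 hT
      rcases Nat.lt_succ_iff_lt_or_eq.1 hs with h' | rfl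
      · exact ih hf hT h' rfl
      · exact hne rfl
    · have := h3 (mem_of_mem_subdivide hT)
      simp only [Finset.mem_range] at this
      omega

theorem Valid.inj {f : ℕ → Finset ℕ} {t s s' : ℕ} (hf : Valid f t) (hs : s < t) (hs' : s' < t)
    (h : f s = f s') : s = s' := by
  rcases lt_trichotomy s s' with hlt | rfl | hlt
  · exact absurd h (ne_of_mem_boundedFaces (hf.mono hs'.le) (hf s' hs') hlt)
  · rfl
  · exact absurd h.symm (ne_of_mem_boundedFaces (hf.mono hs.le) (hf s hs) hlt)

theorem IsOffspring.mono {f : ℕ → Finset ℕ} {t t' : ℕ} (h : t ≤ t') {T T' : Finset ℕ}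
    (hT : IsOffspring f t T T') : IsOffspring f t' T T' := by
  obtain ⟨s, hs, h1, h2⟩ := hT
  exact ⟨s, hs.trans_le h, h1, h2⟩

/-- The largest corner of an offspring is the vertex added when it was created, so the step, and
with it the parent, can be read off. -/
theorem IsOffspring.parent_unique {f : ℕ → Finset ℕ} {t : ℕ} (hf : Valid f t)
    {y y' x : Finset ℕ} (h : IsOffspring f t y x) (h' : IsOffspring f t y' x) : y = y' := by
  obtain ⟨s, hs, rfl, hx⟩ := h
  obtain ⟨s', hs', rfl, hx'⟩ := h'
  have key : ∀ {a b : ℕ}, b < t → x ∈ subdivide (a + 3) (f a) →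
      x ∈ subdivide (b + 3) (f b) → a ≤ b := by
    intro a b hb ha hb'
    rcases Finset.mem_insert.1 (subset_of_mem_subdivide hb' (mem_of_mem_subdivide ha)) with h | h
    · omega
    · have := (hf.face_spec hb).1 h
      simp only [Finset.mem_range] at this
      omega
  rw [le_antisymm (key hs' hx hx') (key hs hx' hx)]

/-- Further growth adds no grand-offspring inside `J`: a triangle present at time `t` carries the
labels of steps before `t` only, so the two subdivisions leading to it have already happened. Hence
sparse times suffice for the almost sure bound. -/
theorem IsBuonoSubtree.mono {f : ℕ → Finset ℕ} {t t' : ℕ} (hf : Valid f t') (h : t ≤ t')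
    {J : Finset (Finset ℕ)} (hJ : IsBuonoSubtree f t J) : IsBuonoSubtree f t' J := by
  refine ⟨hJ.subset.trans (triangles_mono h), ?_, fun T hT => ?_⟩
  · refine hJ.connected.mono ?_
    intro a b hab
    simp only [SimpleGraph.comap_adj, triangleTree, SimpleGraph.fromRel_adj] at hab ⊢
    exact ⟨hab.1, hab.2.imp (IsOffspring.mono h) (IsOffspring.mono h)⟩
  · refine le_trans (Set.ncard_le_ncard ?_ ?_) (hJ.buono T hT)
    · rintro T'' ⟨hT'', T', ⟨s, hs, rfl, h1⟩, ⟨s', hs', rfl, h2⟩⟩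
      have a2 := (triangle_spec (hf.mono h) (hJ.subset hT'')).1 (mem_of_mem_subdivide h2)
      have a1 := (hf.face_spec hs').1 (mem_of_mem_subdivide h1)
      simp only [Finset.mem_range] at a1 a2
      exact ⟨hT'', f s', ⟨s, by omega, rfl, h1⟩, ⟨s', by omega, rfl, h2⟩⟩
    · exact J.finite_toSet.subset fun x hx => hx.1

/-! ### The labelled triangle-tree -/

/-- Ternary trees with labels at all vertices. -/
inductive LTree : Type
  | leaf (T : Finset ℕ) : LTree
  | node (T : Finset ℕ) (c : Fin 3 → LTree) : LTree

/-- Ternary trees. -/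
inductive TTree : Type
  | leaf : TTree
  | node (c : Fin 3 → TTree) : TTree

namespace TTree

/-- The number of internal nodes. -/
def size : TTree → ℕ
  | leaf => 0
  | node c => 1 + ∑ i, (c i).size

/-- The `i`-th offspring of the root; the offspring of a leaf are leaves. -/
def child (i : Fin 3) : TTree → TTree
  | leaf => leaf
  | node c => c i

end TTree

namespace LTree

/-- The labels of a tree. -/
def labels : LTree → Finset (Finset ℕ)
  | leaf T => {T}
  | node T c => insert T (Finset.univ.biUnion fun i => (c i).labels)

/-- The labels of the leaves of a tree. -/
def leaves : LTree → Finset (Finset ℕ)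
  | leaf T => {T}
  | node _ c => Finset.univ.biUnion fun i => (c i).leaves

/-- The label of the root. -/
def root : LTree → Finset ℕ
  | leaf T => T
  | node T _ => T

/-- Forget the labels. -/
def shape : LTree → TTree
  | leaf _ => .leaf
  | node _ c => .node fun i => (c i).shape

/-- The `i`-th offspring of the root; the offspring of a leaf have the label `∅`. -/
def child (i : Fin 3) : LTree → LTree
  | leaf _ => leaf ∅
  | node _ c => c i

/-- An enumeration of the triangles in `subdivide v S`. -/
def kid (v : ℕ) (S : Finset ℕ) (i : Fin 3) : Finset ℕ :=
  open scoped Classical in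
  if h : (subdivide v S).card = 3 then
    (((subdivide v S).equivFinOfCardEq h).symm i : Finset ℕ)
  else ∅

/-- Replace the leaf with label `S` by a node with three leaves. -/
def grow (v : ℕ) (S : Finset ℕ) : LTree → LTree
  | leaf T => open scoped Classical in
    if T = S then node T (fun i => leaf (kid v S i)) else leaf T
  | node T c => node T fun i => (c i).grow v S

/-- No label occurs twice. -/
def WF : LTree → Prop
  | leaf _ => True
  | node T c => (∀ i, T ∉ (c i).labels) ∧
      (∀ i j, i ≠ j → Disjoint (c i).labels (c j).labels) ∧ ∀ i, (c i).WF

theorem shape_child (i : Fin 3) (U : LTree) : (U.child i).shape = U.shape.child i := by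
  cases U <;> rfl

theorem root_mem_labels (U : LTree) : U.root ∈ U.labels := by
  cases U <;> simp [root, labels]

theorem leaves_subset_labels (U : LTree) : U.leaves ⊆ U.labels := by
  induction U with
  | leaf T => exact subset_rfl
  | node T c ih =>
    exact (Finset.biUnion_mono fun i _ => ih i).trans (Finset.subset_insert _ _)

theorem card_labels_le (U : LTree) : U.labels.card ≤ 3 * U.shape.size + 1 := by
  induction U with
  | leaf T => simp [labels]
  | node T c ih =>
    have h1 : (node T c).labels.card ≤ (∑ i, (c i).labels.card) + 1 :=
      (Finset.card_insert_le _ _).trans (Nat.add_le_add_right Finset.card_biUnion_le 1)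
    simp only [shape, TTree.size, Fin.sum_univ_three] at *
    have := ih 0; have := ih 1; have := ih 2
    omega

theorem grow_of_notMem {v : ℕ} {S : Finset ℕ} {U : LTree} (h : S ∉ U.leaves) :
    U.grow v S = U := by
  induction U with
  | leaf T =>
    have : T ≠ S := fun h' => h (by simp [leaves, h'])
    simp [grow, this]
  | node T c ih =>
    have : ∀ i, (c i).grow v S = c i := fun i => ih i fun h' =>
      h (Finset.mem_biUnion.2 ⟨i, Finset.mem_univ i, h'⟩)
    simp [grow, this]

theorem root_grow (v : ℕ) (S : Finset ℕ) (U : LTree) : (U.grow v S).root = U.root := by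
  cases U with
  | leaf T =>
    by_cases h : T = S <;> simp [grow, root, h]
  | node T c => rfl

theorem image_kid {v : ℕ} {S : Finset ℕ} (hS : (subdivide v S).card = 3) :
    Finset.univ.image (kid v S) = subdivide v S := by
  ext T
  simp only [Finset.mem_image, Finset.mem_univ, true_and, kid, hS, dite_true]
  constructor
  · rintro ⟨i, rfl⟩
    exact Finset.coe_mem _
  · intro hT
    exact ⟨(subdivide v S).equivFinOfCardEq hS ⟨T, hT⟩, by simp⟩

theorem kid_injective {v : ℕ} {S : Finset ℕ} (hS : (subdivide v S).card = 3) :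
    Function.Injective (kid v S) := by
  intro i j hij
  simp only [kid, hS, dite_true] at hij
  exact ((subdivide v S).equivFinOfCardEq hS).symm.injective (Subtype.ext hij)

theorem kid_mem {v : ℕ} {S : Finset ℕ} (hS : (subdivide v S).card = 3) (i : Fin 3) :
    kid v S i ∈ subdivide v S := by
  rw [← image_kid hS]
  exact Finset.mem_image_of_mem _ (Finset.mem_univ i)

theorem labels_grow {v : ℕ} {S : Finset ℕ} (hS : (subdivide v S).card = 3) (U : LTree) :
    (U.grow v S).labels = U.labels ∪ if S ∈ U.leaves then subdivide v S else ∅ := by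
  induction U with
  | leaf T =>
    by_cases h : T = S
    · subst h
      rw [← image_kid hS]
      simp only [grow, labels, leaves, if_true, Finset.mem_singleton]
      ext x
      simp [eq_comm]
    · have h' : S ≠ T := Ne.symm h
      simp [grow, labels, leaves, h, h']
  | node T c ih =>
    simp only [grow, labels, leaves, ih]
    ext x
    simp only [Finset.mem_insert, Finset.mem_biUnion, Finset.mem_univ, true_and,
      Finset.mem_union]
    split_ifs with h
    · obtain ⟨i, hi⟩ := h
      constructor
      · rintro (h | ⟨j, h | h⟩)
        · exact .inl (.inl h)
        · exact .inl (.inr ⟨j, h⟩)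
        · split_ifs at h
          · exact .inr h
          · simp at h
      · rintro ((h | ⟨j, h⟩) | h)
        · exact .inl h
        · exact .inr ⟨j, .inl h⟩
        · exact .inr ⟨i, .inr (by simpa [hi] using h)⟩
    · have : ∀ i, S ∉ (c i).leaves := fun i hi => h ⟨i, hi⟩
      simp [this]

theorem leaves_grow {v : ℕ} {S : Finset ℕ} (hS : (subdivide v S).card = 3) {U : LTree}
    (hU : U.WF) (hSU : S ∈ U.leaves) :
    (U.grow v S).leaves = U.leaves.erase S ∪ subdivide v S := by
  induction U with
  | leaf T =>
    obtain rfl : S = T := Finset.mem_singleton.1 hSU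
    rw [← image_kid hS]
    simp only [grow, leaves, if_true]
    ext x
    simp [eq_comm]
  | node T c ih =>
    obtain ⟨i, -, hi⟩ := Finset.mem_biUnion.1 hSU
    have hj : ∀ j, j ≠ i → S ∉ (c j).leaves := fun j hji h =>
      Finset.disjoint_left.1 (hU.2.1 j i hji) (leaves_subset_labels _ h)
        (leaves_subset_labels _ hi)
    have h1 := ih i (hU.2.2 i) hi
    simp only [grow, leaves]
    ext x
    simp only [Finset.mem_biUnion, Finset.mem_univ, true_and, Finset.mem_union,
      Finset.mem_erase]
    constructor
    · rintro ⟨j, h⟩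
      by_cases hji : j = i
      · subst hji
        rw [h1] at h
        rcases Finset.mem_union.1 h with h | h
        · exact .inl ⟨(Finset.mem_erase.1 h).1, j, (Finset.mem_erase.1 h).2⟩
        · exact .inr h
      · rw [grow_of_notMem (hj j hji)] at h
        exact .inl ⟨fun h' => hj j hji (h' ▸ h), j, h⟩
    · rintro (⟨hx, j, h⟩ | h)
      · by_cases hji : j = i
        · subst hji
          exact ⟨j, by rw [h1]; exact Finset.mem_union_left _ (Finset.mem_erase.2 ⟨hx, h⟩)⟩
        · exact ⟨j, by rwa [grow_of_notMem (hj j hji)]⟩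
      · exact ⟨i, by rw [h1]; exact Finset.mem_union_right _ h⟩

/-- Distinct labels guarantee that growing at a label changes exactly one leaf, which is needed to
match the choice of a face with the choice of a leaf. -/
theorem WF.grow {v : ℕ} {S : Finset ℕ} (hS : (subdivide v S).card = 3) {U : LTree}
    (hU : U.WF) (hnew : Disjoint U.labels (subdivide v S)) : (U.grow v S).WF := by
  induction U with
  | leaf T =>
    by_cases h : T = S
    · subst h
      simp only [LTree.grow, if_true, WF, labels, Finset.mem_singleton, implies_true, and_true]
      refine ⟨fun i hi => ?_, fun i j hij => ?_⟩
      · have hk := kid_mem hS i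
        rw [← hi] at hk
        exact Finset.disjoint_left.1 hnew (Finset.mem_singleton_self T) hk
      · exact Finset.disjoint_singleton.2 fun h => hij (kid_injective hS h)
    · simp [LTree.grow, h, WF]
  | node T c ih =>
    have hsub : ∀ i, (c i).labels ⊆ (node T c).labels := fun i =>
      (Finset.subset_biUnion_of_mem (fun i => (c i).labels) (Finset.mem_univ i)).trans
        (Finset.subset_insert _ _)
    have hd : ∀ i, Disjoint (c i).labels (subdivide v S) := fun i =>
      Finset.disjoint_of_subset_left (hsub i) hnew
    have hT : T ∉ subdivide v S := Finset.disjoint_left.1 hnew (Finset.mem_insert_self _ _)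
    refine ⟨fun i => ?_, fun i j hij => ?_, fun i => ih i (hU.2.2 i) (hd i)⟩
    · rw [labels_grow hS, Finset.mem_union, not_or]
      refine ⟨hU.1 i, ?_⟩
      split_ifs
      · exact hT
      · simp
    · rw [labels_grow hS, labels_grow hS]
      by_cases hi : S ∈ (c i).leaves
      · have hj : S ∉ (c j).leaves := fun h =>
          Finset.disjoint_left.1 (hU.2.1 i j hij) (leaves_subset_labels _ hi)
            (leaves_subset_labels _ h)
        simp only [hi, hj, if_true, if_false, Finset.union_empty]
        exact Finset.disjoint_union_left.2 ⟨hU.2.1 i j hij, (hd j).symm⟩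
      · simp only [hi, if_false, Finset.union_empty]
        refine Finset.disjoint_union_right.2 ⟨hU.2.1 i j hij, ?_⟩
        split_ifs
        · exact hd i
        · simp

end LTree

/-- The triangle-tree after `t` steps as a labelled tree. -/
def ltree (f : ℕ → Finset ℕ) : ℕ → LTree
  | 0 => .leaf {0, 1, 2}
  | t + 1 => (ltree f t).grow (t + 3) (f t)

theorem ltree_congr {f g : ℕ → Finset ℕ} {t : ℕ} (h : ∀ s < t, f s = g s) :
    ltree f t = ltree g t := by
  induction t with
  | zero => rfl
  | succ t ih =>
    simp only [ltree, ih fun s hs => h s (hs.trans (Nat.lt_succ_self t)),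
      h t (Nat.lt_succ_self t)]

theorem Valid.card_subdivide {f : ℕ → Finset ℕ} {t s : ℕ} (hf : Valid f t) (hs : s < t) :
    (subdivide (s + 3) (f s)).card = 3 := by
  rw [RAN.card_subdivide (hf.face_spec hs).2.2, (hf.face_spec hs).2.1]

theorem ltree_spec {f : ℕ → Finset ℕ} {t : ℕ} (hf : Valid f t) :
    (ltree f t).WF ∧ (ltree f t).leaves = boundedFaces f t ∧
      (ltree f t).labels = triangles f t := by
  induction t with
  | zero => exact ⟨trivial, rfl, rfl⟩
  | succ t ih =>
    have hS := hf.card_subdivide (Nat.lt_succ_self t)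
    obtain ⟨hf, hft⟩ := valid_succ.1 hf
    obtain ⟨h1, h2, h3⟩ := ih hf
    refine ⟨h1.grow hS ?_, ?_, ?_⟩
    · rw [h3]
      refine Finset.disjoint_left.2 fun T hT hT' => ?_
      simpa using (triangle_spec hf hT).1 (mem_of_mem_subdivide hT')
    · rw [ltree, LTree.leaves_grow hS h1 (by rwa [h2]), h2]
      rfl
    · rw [ltree, LTree.labels_grow hS, h3, h2, if_pos hft]
      rfl

/-! ### The offspring relation inside the labelled tree, and the branch that a buono subtree misses.
-/

namespace LTree

/-- The offspring relation of the tree is that of the network after `t` steps. -/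
def Consistent (f : ℕ → Finset ℕ) (t : ℕ) : LTree → Prop
  | leaf T => ∀ s < t, f s ≠ T
  | node T c => (∃ s < t, f s = T ∧
      (Finset.univ.image fun i => (c i).root) = subdivide (s + 3) T) ∧
        ∀ i, (c i).Consistent f t

theorem Consistent.grow {f : ℕ → Finset ℕ} {t : ℕ} (hf : Valid f (t + 1)) {U : LTree}
    (hU : U.Consistent f t) : (U.grow (t + 3) (f t)).Consistent f (t + 1) := by
  have hS := hf.card_subdivide (Nat.lt_succ_self t)
  induction U with
  | leaf T =>
    by_cases h : T = f t
    · subst h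
      simp only [LTree.grow, if_true]
      refine ⟨⟨t, Nat.lt_succ_self t, rfl, image_kid hS⟩, fun i s hs h => ?_⟩
      have := (hf.face_spec hs).1 (h ▸ mem_of_mem_subdivide (kid_mem hS i))
      simp only [Finset.mem_range] at this
      omega
    · simp only [LTree.grow, h, if_false]
      intro s hs
      rcases Nat.lt_succ_iff_lt_or_eq.1 hs with h' | rfl
      · exact hU s h'
      · exact Ne.symm h
  | node T c ih =>
    obtain ⟨⟨s, hs, h1, h2⟩, h3⟩ := hU
    refine ⟨⟨s, hs.trans (Nat.lt_succ_self t), h1, ?_⟩, fun i => ih i (h3 i)⟩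
    simpa only [root_grow] using h2

theorem child_labels_subset {T : Finset ℕ} {c : Fin 3 → LTree} (i : Fin 3) :
    (c i).labels ⊆ (node T c).labels :=
  (Finset.subset_biUnion_of_mem (fun i => (c i).labels) (Finset.mem_univ i)).trans
    (Finset.subset_insert _ _)

theorem Consistent.isOffspring_child {f : ℕ → Finset ℕ} {t : ℕ} {T : Finset ℕ}
    {c : Fin 3 → LTree} (hU : (node T c).Consistent f t) (i : Fin 3) :
    IsOffspring f t T (c i).root := by
  obtain ⟨⟨s, hs, h1, h2⟩, -⟩ := hU
  exact ⟨s, hs, h1, h2 ▸ Finset.mem_image_of_mem (fun i => (c i).root) (Finset.mem_univ i)⟩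

/-- A leaf has never been subdivided, and a triangle is subdivided at most once (`Valid.inj`), so
the step recorded at a node accounts for all its offspring. -/
theorem Consistent.closed {f : ℕ → Finset ℕ} {t : ℕ} (hf : Valid f t) {U : LTree}
    (hU : U.Consistent f t) {x y : Finset ℕ} (hx : x ∈ U.labels) (h : IsOffspring f t x y) :
    y ∈ U.labels := by
  induction U with
  | leaf T =>
    obtain rfl := Finset.mem_singleton.1 hx
    obtain ⟨s, hs, h1, -⟩ := h
    exact absurd h1 (hU s hs)
  | node T c ih =>
    rcases Finset.mem_insert.1 hx with rfl | hx
    · obtain ⟨s', hs', rfl, hy⟩ := h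
      obtain ⟨⟨s, hs, h1, h2⟩, -⟩ := hU
      obtain rfl := hf.inj hs hs' h1
      rw [← h2] at hy
      obtain ⟨i, -, rfl⟩ := Finset.mem_image.1 hy
      exact child_labels_subset i (root_mem_labels _)
    · obtain ⟨i, -, hi⟩ := Finset.mem_biUnion.1 hx
      exact child_labels_subset i (ih i (hU.2 i) hi)

theorem Consistent.exists_parent {f : ℕ → Finset ℕ} {t : ℕ} {U : LTree}
    (hU : U.Consistent f t) {x : Finset ℕ} (hx : x ∈ U.labels) (hr : x ≠ U.root) :
    ∃ y ∈ U.labels, IsOffspring f t y x := by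
  induction U with
  | leaf T => exact absurd (Finset.mem_singleton.1 hx) hr
  | node T c ih =>
    rcases Finset.mem_insert.1 hx with rfl | hx
    · exact absurd rfl hr
    · obtain ⟨i, -, hi⟩ := Finset.mem_biUnion.1 hx
      by_cases hxi : x = (c i).root
      · exact ⟨T, Finset.mem_insert_self _ _, hxi ▸ hU.isOffspring_child i⟩
      · obtain ⟨y, hy, h⟩ := ih i (hU.2 i) hi hxi
        exact ⟨y, child_labels_subset i hy, h⟩

/-- A connected set that meets a branch of the tree and leaves it contains the root of the branch
and the parent of this root. -/
theorem Consistent.cut {f : ℕ → Finset ℕ} {t : ℕ} (hf : Valid f t) {V : LTree}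
    (hV : V.Consistent f t) {J : Finset (Finset ℕ)} (hJ : IsBuonoSubtree f t J)
    {x y : Finset ℕ} (hx : x ∈ J) (hxV : x ∈ V.labels) (hy : y ∈ J) (hyV : y ∉ V.labels) :
    ∃ p ∈ J, V.root ∈ J ∧ IsOffspring f t p V.root := by
  obtain ⟨w⟩ := hJ.connected.preconnected ⟨x, hx⟩ ⟨y, hy⟩
  obtain ⟨d, -, hd1, hd2⟩ := w.exists_boundary_dart {z | z.1 ∈ V.labels} hxV hyV
  have hadj := d.adj
  simp only [SimpleGraph.comap_adj, triangleTree, SimpleGraph.fromRel_adj] at hadj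
  rcases hadj.2 with h | h
  · exact absurd (hV.closed hf hd1 h) hd2
  · have hr : (d.fst : Finset ℕ) = V.root := by
      by_contra hr
      obtain ⟨z, hz, hz'⟩ := hV.exists_parent hd1 hr
      have hdz : (d.snd : Finset ℕ) = z := h.parent_unique hf hz'
      exact hd2 (show (d.snd : Finset ℕ) ∈ V.labels from hdz ▸ hz)
    exact ⟨d.snd, d.snd.2, hr ▸ d.fst.2, hr ▸ h⟩

/-- A buono subtree misses at least one of the nine branches two levels below any vertex. -/
theorem exists_disjoint_branch {f : ℕ → Finset ℕ} {t : ℕ} (hf : Valid f t) {U : LTree}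
    (hc : U.Consistent f t) (hwf : U.WF) {J : Finset (Finset ℕ)} (hJ : IsBuonoSubtree f t J) :
    ∃ i j, Disjoint J ((U.child i).child j).labels := by
  -- The dummy label `∅` below leaves is no triangle, so a dummy branch is always missed.
  have hJ0 : ∅ ∉ J := fun h => by
    have := (triangle_spec hf (hJ.subset h)).2
    simp at this
  have hleaf : Disjoint J (leaf ∅).labels := Finset.disjoint_singleton_right.2 hJ0
  cases U with
  | leaf T => exact ⟨0, 0, hleaf⟩
  | node T c =>
    by_contra! hcon
    have hnode : ∀ i, ∃ S d, c i = node S d := by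
      intro i
      cases hci : c i with
      | leaf S => exact absurd hleaf (by simpa [child, hci] using hcon i 0)
      | node S d => exact ⟨S, d, rfl⟩
    choose S d hd using hnode
    have hW : ∀ i j, ∃ x ∈ J, x ∈ (d i j).labels := by
      intro i j
      have := hcon i j
      simp only [child, hd] at this
      exact Finset.not_disjoint_iff.1 this
    have hsub : ∀ i j, (d i j).labels ⊆ (c i).labels := fun i j => by
      rw [hd]; exact child_labels_subset j
    have hdisj : ∀ i j i' j', (i, j) ≠ (i', j') → Disjoint (d i j).labels (d i' j').labels := by
      intro i j i' j' hne
      by_cases hi : i = i'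
      · subst hi
        have := hwf.2.2 i
        rw [hd] at this
        exact this.2.1 j j' fun h => hne (by rw [h])
      · exact Finset.disjoint_of_subset_left (hsub i j)
          (Finset.disjoint_of_subset_right (hsub i' j') (hwf.2.1 i i' hi))
    obtain ⟨x, hx, hxW⟩ := hW 0 0
    obtain ⟨y, hy, hyW⟩ := hW 1 0
    -- Two disjoint first-level branches both meet `J`, so a path in `J` between them runs through
    -- their common parent.
    have hT : T ∈ J := by
      obtain ⟨p, hp, -, hp'⟩ := (hc.2 0).cut hf hJ hx (hsub 0 0 hxW) hy fun h =>
        Finset.disjoint_left.1 (hwf.2.1 0 1 (by decide)) h (hsub 1 0 hyW)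
      rwa [hp'.parent_unique hf (hc.isOffspring_child 0)] at hp
    have hcd : ∀ i, (node (S i) (d i)).Consistent f t := fun i => by
      rw [← hd]; exact hc.2 i
    -- A path in `J` from inside a second-level branch up to `T` leaves through the root of that
    -- branch; this puts nine distinct grand-offspring of `T` into `J`.
    have hroot : ∀ p : Fin 3 × Fin 3, (d p.1 p.2).root ∈
        {T'' | T'' ∈ J ∧ IsGrandOffspring f t T T''} := by
      rintro ⟨i, j⟩
      obtain ⟨z, hz, hzW⟩ := hW i j
      obtain ⟨p, -, hr, -⟩ := ((hcd i).2 j).cut hf hJ hz hzW hT fun h => hwf.1 i (hsub i j h)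
      refine ⟨hr, S i, ?_, (hcd i).isOffspring_child j⟩
      have := hc.isOffspring_child i
      rwa [hd] at this
    have hinj : Function.Injective fun p : Fin 3 × Fin 3 => (d p.1 p.2).root := by
      intro p q hpq
      by_contra hne
      refine Finset.disjoint_left.1 (hdisj p.1 p.2 q.1 q.2 hne) (root_mem_labels _) ?_
      rw [show (d p.1 p.2).root = (d q.1 q.2).root from hpq]
      exact root_mem_labels _
    have h9 : (Set.range fun p : Fin 3 × Fin 3 => (d p.1 p.2).root).ncard = 9 := by
      rw [← Set.image_univ, Set.ncard_image_of_injective _ hinj, Set.ncard_univ]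
      simp
    have := (Set.ncard_le_ncard (Set.range_subset_iff.2 hroot)
      (J.finite_toSet.subset fun x hx => hx.1)).trans (hJ.buono T hT)
    omega

theorem card_inter_labels_le (U : LTree) (J : Finset (Finset ℕ)) :
    (J ∩ U.labels).card ≤ 1 + ∑ i, (J ∩ (U.child i).labels).card := by
  cases U with
  | leaf T =>
    refine le_trans (Finset.card_le_card Finset.inter_subset_right) ?_
    simp [labels]
  | node T c =>
    have : J ∩ (node T c).labels ⊆ insert T (Finset.univ.biUnion fun i => J ∩ (c i).labels) := by
      intro x hx
      simp only [labels, Finset.mem_inter, Finset.mem_insert, Finset.mem_biUnion] at hx ⊢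
      tauto
    refine (Finset.card_le_card this).trans ((Finset.card_insert_le _ _).trans ?_)
    rw [add_comm]
    exact Nat.add_le_add_left Finset.card_biUnion_le 1

end LTree

theorem ltree_consistent {f : ℕ → Finset ℕ} {t : ℕ} (hf : Valid f t) :
    (ltree f t).Consistent f t := by
  induction t with
  | zero => exact fun s hs => absurd hs (Nat.not_lt_zero s)
  | succ t ih => exact (ih (valid_succ.1 hf).1).grow hf

/-! ### The potential -/

namespace TTree

/-- The sizes of the nine branches two levels below the root. -/
def gsize (T : TTree) (i j : Fin 3) : ℕ := ((T.child i).child j).size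

/-- The least entry of a `3 × 3` array. -/
def minEntry (b : Fin 3 → Fin 3 → ℕ) : ℕ :=
  (Finset.univ : Finset (Fin 3 × Fin 3)).inf' Finset.univ_nonempty fun p => b p.1 p.2

/-- The largest share of the tree that is not covered by a branch two levels below the root. -/
def ratio (T : TTree) : ℝ := ((T.size : ℝ) - minEntry T.gsize) / T.size

/-- The largest product of the ratios along a path with `k` double levels all of whose vertices
have at least `L` descendants. -/
def potential (L : ℕ) : ℕ → TTree → ℝ
  | 0, _ => 1
  | k + 1, T => if T.size < L then 0 else
      T.ratio * (Finset.univ : Finset (Fin 3 × Fin 3)).sup' Finset.univ_nonempty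
        fun p => potential L k ((T.child p.1).child p.2)

theorem minEntry_le (b : Fin 3 → Fin 3 → ℕ) (i j : Fin 3) : minEntry b ≤ b i j :=
  Finset.inf'_le (fun p : Fin 3 × Fin 3 => b p.1 p.2) (Finset.mem_univ (i, j))

theorem sum_size_child_le (T : TTree) : ∑ i, (T.child i).size ≤ T.size := by
  cases T with
  | leaf => simp [child, size]
  | node c => simp [child, size]

theorem sum_gsize_le (T : TTree) : ∑ i, ∑ j, T.gsize i j ≤ T.size :=
  (Finset.sum_le_sum fun i _ => sum_size_child_le (T.child i)).trans (sum_size_child_le T)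

theorem minEntry_gsize_le (T : TTree) : minEntry T.gsize ≤ T.size := by
  refine (minEntry_le _ 0 0).trans (le_trans ?_ T.sum_gsize_le)
  simp only [Fin.sum_univ_three]
  omega

theorem ratio_nonneg (T : TTree) : 0 ≤ T.ratio :=
  div_nonneg (sub_nonneg.2 (Nat.cast_le.2 T.minEntry_gsize_le)) (Nat.cast_nonneg _)

theorem potential_nonneg (L k : ℕ) (T : TTree) : 0 ≤ potential L k T := by
  induction k generalizing T with
  | zero => exact zero_le_one
  | succ k ih =>
    simp only [potential]
    split_ifs
    · exact le_rfl
    · exact mul_nonneg T.ratio_nonneg ((ih _).trans (Finset.le_sup'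
        (fun p : Fin 3 × Fin 3 => potential L k ((T.child p.1).child p.2))
        (Finset.mem_univ ((0, 0) : Fin 3 × Fin 3))))

end TTree

/-- Induction over double levels. The missed branch has at least `minEntry` subdivisions, so the
other eight share at most `size * ratio`. The summand `+ 1` on the left absorbs the four vertices in
the top two levels: eight branches supply eight such units and only five are needed. -/
theorem card_inter_labels_le_potential {L : ℕ} (hL : 1 ≤ L) (J : Finset (Finset ℕ))
    (Q : LTree → Prop) (hQ : ∀ U, Q U → ∀ i, Q (U.child i))
    (hQJ : ∀ U, Q U → ∃ i j, Disjoint J ((U.child i).child j).labels)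
    (k : ℕ) (U : LTree) (hU : Q U) :
    ((J ∩ U.labels).card : ℝ) + 1 ≤
      (3 * L + 2) * 8 ^ k + 3 * U.shape.size * TTree.potential L k U.shape := by
  have htriv : ∀ V : LTree, ((J ∩ V.labels).card : ℝ) ≤ 3 * V.shape.size + 1 := fun V => by
    exact_mod_cast (Finset.card_le_card Finset.inter_subset_right).trans V.card_labels_le
  induction k generalizing U with
  | zero =>
    have := htriv U
    have hL' : (1 : ℝ) ≤ L := by exact_mod_cast hL
    simp only [pow_zero, TTree.potential]
    linarith
  | succ k ih =>
    simp only [TTree.potential]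
    have h8 : (1 : ℝ) ≤ 8 ^ (k + 1) := one_le_pow₀ (by norm_num)
    split_ifs with hs
    -- A small tree has at most `3 * L + 1` labels; this fixes the constant `3 * L + 2`.
    · have h1 := htriv U
      have h2 : (U.shape.size : ℝ) ≤ L := by exact_mod_cast hs.le
      have h3 : (0 : ℝ) ≤ L := Nat.cast_nonneg L
      nlinarith
    · set M := (Finset.univ : Finset (Fin 3 × Fin 3)).sup' Finset.univ_nonempty
        fun p => TTree.potential L k ((U.shape.child p.1).child p.2) with hM
      have hpM : ∀ i j, TTree.potential L k ((U.shape.child i).child j) ≤ M := fun i j =>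
        Finset.le_sup' (fun p : Fin 3 × Fin 3 =>
          TTree.potential L k ((U.shape.child p.1).child p.2)) (Finset.mem_univ (i, j))
      have hM0 : 0 ≤ M := (TTree.potential_nonneg L k _).trans (hpM 0 0)
      obtain ⟨i₀, j₀, hd⟩ := hQJ U hU
      have hN0 : (J ∩ ((U.child i₀).child j₀).labels).card = 0 :=
        Finset.card_eq_zero.2 (Finset.disjoint_iff_inter_eq_empty.1 hd)
      have hN : (J ∩ U.labels).card ≤
          4 + ∑ p : Fin 3 × Fin 3, (J ∩ ((U.child p.1).child p.2).labels).card := by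
        refine (U.card_inter_labels_le J).trans ?_
        have : ∑ i, (J ∩ (U.child i).labels).card ≤
            ∑ i, (1 + ∑ j, (J ∩ ((U.child i).child j).labels).card) :=
          Finset.sum_le_sum fun i _ => (U.child i).card_inter_labels_le J
        rw [Finset.sum_add_distrib] at this
        rw [Fintype.sum_prod_type]
        simp only [Finset.sum_const, Finset.card_univ, Fintype.card_fin, smul_eq_mul] at this ⊢
        omega
      rw [← Finset.add_sum_erase _ _ (Finset.mem_univ (i₀, j₀)), hN0, zero_add] at hN
      have hcard : ((Finset.univ : Finset (Fin 3 × Fin 3)).erase (i₀, j₀)).card = 8 := by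
        rw [Finset.card_erase_of_mem (Finset.mem_univ _)]; simp
      have hsum : ∑ p ∈ (Finset.univ : Finset (Fin 3 × Fin 3)).erase (i₀, j₀),
          (((J ∩ ((U.child p.1).child p.2).labels).card : ℝ) + 1) ≤
          ∑ p ∈ (Finset.univ : Finset (Fin 3 × Fin 3)).erase (i₀, j₀),
          ((3 * L + 2) * 8 ^ k + 3 * (U.shape.gsize p.1 p.2) * M) := by
        refine Finset.sum_le_sum fun p _ => ?_
        refine (ih _ (hQ _ (hQ _ hU p.1) p.2)).trans ?_
        rw [LTree.shape_child, LTree.shape_child]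
        exact add_le_add_right (mul_le_mul_of_nonneg_left (hpM p.1 p.2) (by positivity)) _
      rw [Finset.sum_add_distrib, Finset.sum_add_distrib, Finset.sum_const, Finset.sum_const,
        hcard, ← Finset.sum_mul, ← Finset.mul_sum] at hsum
      have hg : ∑ p ∈ (Finset.univ : Finset (Fin 3 × Fin 3)).erase (i₀, j₀),
          (U.shape.gsize p.1 p.2 : ℝ) ≤ U.shape.size - TTree.minEntry U.shape.gsize := by
        have h1 := U.shape.sum_gsize_le
        rw [← Fintype.sum_prod_type', ← Finset.add_sum_erase _ _ (Finset.mem_univ (i₀, j₀))] at h1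
        have h2 := TTree.minEntry_le U.shape.gsize i₀ j₀
        rw [le_sub_iff_add_le]
        norm_cast
        simp only at h1
        omega
      have hR : (U.shape.size : ℝ) * U.shape.ratio =
          U.shape.size - TTree.minEntry U.shape.gsize := by
        rw [TTree.ratio, mul_div_cancel₀]
        have : 1 ≤ U.shape.size := hL.trans (not_lt.1 hs)
        positivity
      have hN' : ((J ∩ U.labels).card : ℝ) ≤
          4 + ∑ p ∈ (Finset.univ : Finset (Fin 3 × Fin 3)).erase (i₀, j₀),
            ((J ∩ ((U.child p.1).child p.2).labels).card : ℝ) := by exact_mod_cast hN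
      have hgM := mul_le_mul_of_nonneg_right hg hM0
      have : 3 * (U.shape.size : ℝ) * (U.shape.ratio * M) =
          3 * ((U.shape.size - TTree.minEntry U.shape.gsize) * M) := by
        rw [← hR]; ring
      rw [this, pow_succ]
      simp only [nsmul_eq_mul, Nat.cast_ofNat, mul_one] at hsum
      linarith

/-- Bound for the size of a buono subtree in terms of the potential. -/
theorem IsBuonoSubtree.card_le {f : ℕ → Finset ℕ} {t : ℕ} (hf : Valid f t) {L : ℕ} (hL : 1 ≤ L)
    {J : Finset (Finset ℕ)} (hJ : IsBuonoSubtree f t J) (k : ℕ) :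
    (J.card : ℝ) ≤ (3 * L + 2) * 8 ^ k +
      3 * (ltree f t).shape.size * TTree.potential L k (ltree f t).shape := by
  have hJ0 : ∅ ∉ J := fun h => by
    have := (triangle_spec hf (hJ.subset h)).2
    simp at this
  have h := card_inter_labels_le_potential hL J
    -- The dummy leaf is included to make the class closed under `child`.
    (fun U => U = .leaf ∅ ∨ (U.Consistent f t ∧ U.WF)) ?_ ?_ k (ltree f t)
    (.inr ⟨ltree_consistent hf, (ltree_spec hf).1⟩)
  · rw [(ltree_spec hf).2.2, Finset.inter_eq_left.2 hJ.subset] at h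
    linarith
  · rintro U (rfl | ⟨h1, h2⟩) i
    · exact .inl rfl
    · cases U with
      | leaf T => exact .inl rfl
      | node T c => exact .inr ⟨h1.2 i, h2.2.2 i⟩
  · rintro U (rfl | ⟨h1, h2⟩)
    · exact ⟨0, 0, Finset.disjoint_singleton_right.2 hJ0⟩
    · exact LTree.exists_disjoint_branch hf h1 h2 hJ

/-! ### The law of the shape of the triangle-tree -/

namespace TTree

/-- The sum of `φ` over all trees that arise from a tree by growing one leaf. -/
def growSum : TTree → (TTree → ℝ) → ℝ
  | leaf, φ => φ (node fun _ => leaf)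
  | node c, φ => ∑ i, (c i).growSum fun d => φ (node (Function.update c i d))

/-- The mean of `φ` over all trees that arise from `T` by growing one leaf. -/
def avg (φ : TTree → ℝ) (T : TTree) : ℝ := T.growSum φ / (2 * T.size + 1)

/-- The mean of `φ` over the tree that arises from a leaf in `t` uniform growth steps. -/
def law (t : ℕ) (φ : TTree → ℝ) : ℝ := avg^[t] φ leaf

theorem growSum_add (T : TTree) (φ ψ : TTree → ℝ) :
    T.growSum (fun d => φ d + ψ d) = T.growSum φ + T.growSum ψ := by
  induction T generalizing φ ψ with
  | leaf => rfl
  | node c ih =>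
    simp only [growSum]
    rw [← Finset.sum_add_distrib]
    exact Finset.sum_congr rfl fun i _ => ih i _ _

theorem growSum_const_mul (T : TTree) (a : ℝ) (φ : TTree → ℝ) :
    T.growSum (fun d => a * φ d) = a * T.growSum φ := by
  induction T generalizing φ with
  | leaf => rfl
  | node c ih =>
    simp only [growSum]
    rw [Finset.mul_sum]
    exact Finset.sum_congr rfl fun i _ => ih i _

theorem size_update (c : Fin 3 → TTree) (i : Fin 3) (d : TTree) :
    (node (Function.update c i d)).size + (c i).size = (node c).size + d.size := by
  fin_cases i <;> simp [size, Fin.sum_univ_three] <;> omega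

theorem growSum_mono {T : TTree} {φ ψ : TTree → ℝ}
    (h : ∀ d : TTree, d.size = T.size + 1 → φ d ≤ ψ d) : T.growSum φ ≤ T.growSum ψ := by
  induction T generalizing φ ψ with
  | leaf => exact h _ (by simp [size])
  | node c ih =>
    refine Finset.sum_le_sum fun i _ => ih i fun d hd => h _ ?_
    have := size_update c i d
    omega

/-- A ternary tree with `n` internal nodes has `2 * n + 1` leaves, hence the denominator in `avg`.
-/
theorem growSum_one (T : TTree) : T.growSum (fun _ => 1) = 2 * T.size + 1 := by
  induction T with
  | leaf => simp [growSum, size]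
  | node c ih =>
    simp only [growSum, ih, size, Fin.sum_univ_three]
    push_cast
    ring

theorem avg_add (φ ψ : TTree → ℝ) : avg (fun d => φ d + ψ d) = fun T => avg φ T + avg ψ T := by
  funext T
  rw [avg, growSum_add, add_div]; rfl

theorem avg_const_mul (a : ℝ) (φ : TTree → ℝ) :
    avg (fun d => a * φ d) = fun T => a * avg φ T := by
  funext T
  rw [avg, growSum_const_mul, mul_div_assoc]; rfl

theorem avg_one : avg (fun _ => 1) = fun _ => 1 := by
  funext T
  rw [avg, growSum_one, div_self (by positivity)]

theorem law_succ (t : ℕ) (φ : TTree → ℝ) : law (t + 1) φ = law t (avg φ) := rfl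

theorem law_add (t : ℕ) (φ ψ : TTree → ℝ) :
    law t (fun T => φ T + ψ T) = law t φ + law t ψ := by
  induction t generalizing φ ψ with
  | zero => rfl
  | succ t ih => rw [law_succ, avg_add, ih]; rfl

theorem law_const_mul (t : ℕ) (a : ℝ) (φ : TTree → ℝ) :
    law t (fun T => a * φ T) = a * law t φ := by
  induction t generalizing φ with
  | zero => rfl
  | succ t ih => rw [law_succ, avg_const_mul, ih]; rfl

theorem law_one (t : ℕ) : law t (fun _ => 1) = 1 := by
  induction t with
  | zero => rfl
  | succ t ih => rw [law_succ, avg_one, ih]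

theorem law_const (t : ℕ) (a : ℝ) : law t (fun _ => a) = a := by
  have := law_const_mul t a fun _ => 1
  simpa [law_one] using this

theorem law_mul_const (t : ℕ) (a : ℝ) (φ : TTree → ℝ) :
    law t (fun T => φ T * a) = law t φ * a := by
  simp_rw [mul_comm _ a]
  exact law_const_mul t a φ

theorem law_sum {ι : Type*} (s : Finset ι) (t : ℕ) (φ : ι → TTree → ℝ) :
    law t (fun T => ∑ i ∈ s, φ i T) = ∑ i ∈ s, law t (φ i) := by
  classical
  induction s using Finset.induction_on with
  | empty => simpa using law_const t 0
  | insert i s hi ih =>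
    simp_rw [Finset.sum_insert hi]
    rw [law_add, ih]

theorem law_mono {t : ℕ} {φ ψ : TTree → ℝ} (h : ∀ T : TTree, T.size = t → φ T ≤ ψ T) :
    law t φ ≤ law t ψ := by
  induction t generalizing φ ψ with
  | zero => exact h _ rfl
  | succ t ih =>
    refine ih fun T hT => ?_
    exact div_le_div_of_nonneg_right (growSum_mono fun d hd => h d (by omega)) (by positivity)

theorem law_congr {t : ℕ} {φ ψ : TTree → ℝ} (h : ∀ T : TTree, T.size = t → φ T = ψ T) :
    law t φ = law t ψ :=
  le_antisymm (law_mono fun T hT => (h T hT).le) (law_mono fun T hT => (h T hT).ge)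

theorem law_nonneg {t : ℕ} {φ : TTree → ℝ} (h : ∀ T : TTree, T.size = t → 0 ≤ φ T) :
    0 ≤ law t φ := by
  rw [← law_const t 0]
  exact law_mono h

theorem law_growSum_comm (t : ℕ) (T : TTree) (ψ : TTree → TTree → ℝ) :
    law t (fun m => T.growSum fun d => ψ d m) = T.growSum fun d => law t (ψ d) := by
  induction T generalizing ψ with
  | leaf => rfl
  | node c ih =>
    simp only [growSum]
    rw [law_sum]
    exact Finset.sum_congr rfl fun i _ => ih i _

/-! ### The Pólya urn -/

/-- One step of the urn: the mean of `g` after a ball has been drawn from the state `a`. -/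
def urn (g : (Fin 3 → ℕ) → ℝ) (a : Fin 3 → ℕ) : ℝ :=
  ∑ i, (2 * (a i : ℝ) + 1) / (2 * ∑ j, (a j : ℝ) + 3) * g (a + Pi.single i 1)

/-- The mean of `φ` over a tree whose three branches are independent trees of sizes `a`. -/
def branchLaw (φ : TTree → ℝ) (a : Fin 3 → ℕ) : ℝ :=
  law (a 0) fun l => law (a 1) fun m => law (a 2) fun r => φ (node ![l, m, r])

theorem law_succ_growSum (t : ℕ) (φ : TTree → ℝ) :
    law t (fun T => T.growSum φ) = (2 * t + 1) * law (t + 1) φ := by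
  rw [law_succ, ← law_const_mul]
  refine law_congr fun T hT => ?_
  rw [avg, hT]
  field_simp

/-- A uniform leaf lies in branch `i` with probability proportional to its number of leaves `2 * a i
+ 1`, and is uniform within that branch. So growth keeps the branches independent given their sizes,
and the sizes perform an urn step. -/
theorem branchLaw_avg (φ : TTree → ℝ) (a : Fin 3 → ℕ) :
    branchLaw (avg φ) a = urn (branchLaw φ) a := by
  have h1 : branchLaw (avg φ) a = (2 * ∑ j, (a j : ℝ) + 3)⁻¹ *
      branchLaw (fun T => T.growSum φ) a := by
    unfold branchLaw
    rw [← law_const_mul]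
    refine law_congr fun l hl => ?_
    rw [← law_const_mul]
    refine law_congr fun m hm => ?_
    rw [← law_const_mul]
    refine law_congr fun r hr => ?_
    rw [avg, div_eq_inv_mul]
    congr 2
    simp [size, Fin.sum_univ_three, hl, hm, hr]
    ring
  have h2 : branchLaw (fun T => T.growSum φ) a =
      ∑ i, (2 * (a i : ℝ) + 1) * branchLaw φ (a + Pi.single i 1) := by
    have u0 : ∀ l m r d : TTree, Function.update ![l, m, r] 0 d = ![d, m, r] := by
      intro l m r d; ext i; fin_cases i <;> rfl
    have u1 : ∀ l m r d : TTree, Function.update ![l, m, r] 1 d = ![l, d, r] := by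
      intro l m r d; ext i; fin_cases i <;> rfl
    have u2 : ∀ l m r d : TTree, Function.update ![l, m, r] 2 d = ![l, m, d] := by
      intro l m r d; ext i; fin_cases i <;> rfl
    simp only [branchLaw, growSum, Fin.sum_univ_three, law_add, u0, u1, u2]
    congr 1
    · congr 1
      · simp [law_growSum_comm, law_succ_growSum]
      · simp [law_growSum_comm, law_succ_growSum, law_const_mul]
    · simp [law_succ_growSum, law_const_mul]
  rw [h1, h2, urn, Finset.mul_sum]
  refine Finset.sum_congr rfl fun i _ => ?_
  ring

theorem law_succ_eq_urn (m : ℕ) (φ : TTree → ℝ) :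
    law (m + 1) φ = urn^[m] (branchLaw φ) 0 := by
  induction m generalizing φ with
  | zero =>
    have : (![leaf, leaf, leaf] : Fin 3 → TTree) = fun _ => leaf := by
      ext i; fin_cases i <;> rfl
    simp [law, avg, growSum, size, branchLaw, this]
  | succ m ih =>
    rw [law_succ, ih, Function.iterate_succ_apply, funext (branchLaw_avg φ)]

theorem urn_mono {g h : (Fin 3 → ℕ) → ℝ} {a : Fin 3 → ℕ}
    (H : ∀ i, g (a + Pi.single i 1) ≤ h (a + Pi.single i 1)) : urn g a ≤ urn h a :=
  Finset.sum_le_sum fun i _ => mul_le_mul_of_nonneg_left (H i) (by positivity)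

theorem urn_iterate_mono {m : ℕ} {g h : (Fin 3 → ℕ) → ℝ} {a : Fin 3 → ℕ}
    (H : ∀ b, ∑ i, b i = (∑ i, a i) + m → g b ≤ h b) : urn^[m] g a ≤ urn^[m] h a := by
  induction m generalizing g h with
  | zero => exact H a rfl
  | succ m ih =>
    refine ih fun b hb => urn_mono fun i => H _ ?_
    simp only [Pi.add_apply, Finset.sum_add_distrib, hb, Finset.sum_pi_single', Finset.mem_univ,
      if_true]
    omega

theorem urn_iterate_congr {m : ℕ} {g h : (Fin 3 → ℕ) → ℝ} {a : Fin 3 → ℕ}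
    (H : ∀ b, ∑ i, b i = (∑ i, a i) + m → g b = h b) : urn^[m] g a = urn^[m] h a :=
  le_antisymm (urn_iterate_mono fun b hb => (H b hb).le) (urn_iterate_mono fun b hb => (H b hb).ge)

theorem urn_mul_const (c : ℝ) (g : (Fin 3 → ℕ) → ℝ) :
    urn (fun a => g a * c) = fun a => urn g a * c := by
  funext a
  simp only [urn, Finset.sum_mul, mul_assoc]

theorem urn_iterate_mul_const (m : ℕ) (c : ℝ) (g : (Fin 3 → ℕ) → ℝ) (a : Fin 3 → ℕ) :
    urn^[m] (fun a => g a * c) a = urn^[m] g a * c := by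
  induction m generalizing g with
  | zero => rfl
  | succ m ih => rw [Function.iterate_succ_apply, urn_mul_const, ih]; rfl

/-! ### Branch sizes, and the conditional law of the branches given their sizes. -/

/-- The sizes of the three branches at the root. -/
def csize (T : TTree) (i : Fin 3) : ℕ := (T.child i).size

/-- The mean of `h` over the sizes of the branches of a random tree of size `s`. -/
def split (s : ℕ) (h : (Fin 3 → ℕ) → ℝ) : ℝ := law s fun T => h T.csize

theorem csize_leaf : csize leaf = 0 := by
  funext i; rfl

theorem csize_node (l m r : TTree) : csize (node ![l, m, r]) = ![l.size, m.size, r.size] := by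
  funext i; fin_cases i <;> rfl

theorem vec_eta {α : Type*} (a : Fin 3 → α) : ![a 0, a 1, a 2] = a := by
  funext i; fin_cases i <;> rfl

theorem split_zero (h : (Fin 3 → ℕ) → ℝ) : split 0 h = h 0 := by
  simp [split, law, csize_leaf]

theorem branchLaw_csize (h : (Fin 3 → ℕ) → ℝ) :
    branchLaw (fun T => h T.csize) = h := by
  funext a
  have : branchLaw (fun T => h T.csize) a = branchLaw (fun _ => h a) a := by
    refine law_congr fun l hl => law_congr fun m hm => law_congr fun r hr => ?_
    simp only [csize_node, hl, hm, hr, vec_eta]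
  rw [this]
  simp [branchLaw, law_const]

theorem split_succ (m : ℕ) (h : (Fin 3 → ℕ) → ℝ) : split (m + 1) h = urn^[m] h 0 := by
  rw [split, law_succ_eq_urn, branchLaw_csize]

/-- Given the sizes of the branches, each of them is a random tree of its size. -/
theorem law_csize_mul_le {A : TTree → ℝ} {ρ : ℝ} (hA : ∀ s, law s A ≤ ρ)
    {h : (Fin 3 → ℕ) → ℝ} (hh : ∀ a, 0 ≤ h a) (s : ℕ) (j : Fin 3) :
    law s (fun T => h T.csize * A (T.child j)) ≤ law s (fun T => h T.csize) * ρ := by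
  cases s with
  | zero => exact mul_le_mul_of_nonneg_left (hA 0) (hh _)
  | succ m =>
    rw [law_succ_eq_urn, law_succ_eq_urn, ← urn_iterate_mul_const, branchLaw_csize]
    refine urn_iterate_mono fun a _ => ?_
    have : branchLaw (fun T => h T.csize * A (T.child j)) a =
        branchLaw (fun T => h a * A (T.child j)) a := by
      refine law_congr fun l hl => law_congr fun m hm => law_congr fun r hr => ?_
      simp only [csize_node, hl, hm, hr, vec_eta]
    rw [this]
    simp only [branchLaw, law_const_mul]
    refine mul_le_mul_of_nonneg_left ?_ (hh a)
    fin_cases j <;> simp [child, law_const, hA]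

theorem gsize_node (l m r : TTree) : gsize (node ![l, m, r]) = ![l.csize, m.csize, r.csize] := by
  funext i; fin_cases i <;> rfl

/-- Given the sizes of the nine branches two levels below the root, each of them is a random tree
of its size. -/
theorem law_gsize_mul_le {A : TTree → ℝ} {ρ : ℝ} (hA : ∀ s, law s A ≤ ρ)
    {H : (Fin 3 → Fin 3 → ℕ) → ℝ} (hH : ∀ b, 0 ≤ H b) (s : ℕ) (i j : Fin 3) :
    law s (fun T => H T.gsize * A ((T.child i).child j)) ≤
      law s (fun T => H T.gsize) * ρ := by
  cases s with
  | zero => exact mul_le_mul_of_nonneg_left (hA 0) (hH _)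
  | succ m =>
    rw [law_succ_eq_urn, law_succ_eq_urn, ← urn_iterate_mul_const]
    refine urn_iterate_mono fun a _ => ?_
    simp only [branchLaw, gsize_node]
    -- Only the first-level branch containing the chosen one matters; the other two are averaged
    -- into `h` or held fixed, which reduces each case to `law_csize_mul_le`.
    fin_cases i
    · simp only [child, Fin.zero_eta, Matrix.cons_val_zero, law_mul_const]
      exact law_csize_mul_le hA (h := fun z => law (a 1) fun m => law (a 2) fun r =>
        H ![z, m.csize, r.csize])
        (fun z => law_nonneg fun _ _ => law_nonneg fun _ _ => hH _) (a 0) j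
    · simp only [child, Fin.mk_one, Matrix.cons_val_one, Matrix.cons_val_zero, law_mul_const]
      rw [← law_mul_const]
      refine law_mono fun l _ => ?_
      exact law_csize_mul_le hA (h := fun z => law (a 2) fun r =>
        H ![l.csize, z, r.csize]) (fun z => law_nonneg fun _ _ => hH _) (a 1) j
    · simp only [child, Fin.reduceFinMk, Matrix.cons_val]
      rw [← law_mul_const]
      refine law_mono fun l _ => ?_
      rw [← law_mul_const]
      refine law_mono fun m _ => ?_
      exact law_csize_mul_le hA (h := fun z => H ![l.csize, m.csize, z]) (fun z => hH _) (a 2) j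

theorem law_gsize (m : ℕ) (H : (Fin 3 → Fin 3 → ℕ) → ℝ) :
    law m (fun T => H T.gsize) = split m fun a => split (a 0) fun b₀ => split (a 1) fun b₁ =>
      split (a 2) fun b₂ => H ![b₀, b₁, b₂] := by
  cases m with
  | zero =>
    simp only [split_zero, Pi.zero_apply]
    refine congrArg H ?_
    funext i j
    fin_cases i <;> rfl
  | succ m =>
    rw [split_succ, law_succ_eq_urn]
    refine urn_iterate_congr fun a _ => ?_
    simp only [branchLaw, gsize_node, split]

/-- The power of a maximum over nine branches is at most the sum of the nine powers. The ratio at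
the root depends only on the nine sizes, so `law_gsize_mul_le` separates it from the potentials
below, and every double level contributes a factor `9 * θ`. -/
theorem law_potential_le {lam θ : ℝ} (hlam : 0 < lam) {L : ℕ}
    (hθ : ∀ m, L ≤ m → law m (fun T => T.ratio ^ lam) ≤ θ) (k m : ℕ) :
    law m (fun T => potential L k T ^ lam) ≤ (9 * θ) ^ k := by
  have hθ0 : 0 ≤ θ :=
    (law_nonneg fun T _ => Real.rpow_nonneg T.ratio_nonneg _).trans (hθ L le_rfl)
  induction k generalizing m with
  | zero => simp [potential, law_one]
  | succ k ih =>
    by_cases hm : m < L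
    · have : law m (fun T => potential L (k + 1) T ^ lam) = law m fun _ => 0 :=
        law_congr fun T hT => by simp [potential, hT, hm, Real.zero_rpow hlam.ne']
      rw [this, law_const]
      positivity
    -- The ratio with total size frozen at `m`; truncation at `0` makes it nonnegative also for
    -- arrays that no tree of size `m` realizes.
    · set H : (Fin 3 → Fin 3 → ℕ) → ℝ := fun b => max (((m : ℝ) - minEntry b) / m) 0 ^ lam
        with hHdef
      have hH : ∀ b, 0 ≤ H b := fun b => Real.rpow_nonneg (le_max_right _ _) _
      have hHr : ∀ T : TTree, T.size = m → H T.gsize = T.ratio ^ lam := fun T hT => by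
        have h0 := T.ratio_nonneg
        rw [ratio, hT] at h0
        simp only [hHdef, ratio, hT, max_eq_left h0]
      have h1 : law m (fun T => potential L (k + 1) T ^ lam) ≤ law m fun T =>
          ∑ p : Fin 3 × Fin 3, H T.gsize * potential L k ((T.child p.1).child p.2) ^ lam := by
        refine law_mono fun T hT => ?_
        simp only [potential, hT, hm, if_false]
        obtain ⟨p, -, hp⟩ := Finset.exists_mem_eq_sup' (s := (Finset.univ : Finset (Fin 3 × Fin 3)))
          Finset.univ_nonempty fun p => potential L k ((T.child p.1).child p.2)
        rw [hp, Real.mul_rpow T.ratio_nonneg (potential_nonneg _ _ _), ← hHr T hT]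
        exact Finset.single_le_sum (f := fun p : Fin 3 × Fin 3 =>
          H T.gsize * potential L k ((T.child p.1).child p.2) ^ lam)
          (fun q _ => mul_nonneg (hH _) (Real.rpow_nonneg (potential_nonneg _ _ _) _))
          (Finset.mem_univ p)
      refine h1.trans ?_
      rw [law_sum]
      have h2 : law m (fun T => H T.gsize) ≤ θ := by
        rw [law_congr hHr]
        exact hθ m (not_lt.1 hm)
      have h3 : ∀ p ∈ (Finset.univ : Finset (Fin 3 × Fin 3)), law m (fun T =>
          H T.gsize * potential L k ((T.child p.1).child p.2) ^ lam) ≤ θ * (9 * θ) ^ k :=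
        fun p _ => (law_gsize_mul_le (A := fun T => potential L k T ^ lam) ih hH m p.1 p.2).trans
          (mul_le_mul_of_nonneg_right h2 (by positivity))
      refine (Finset.sum_le_sum h3).trans ?_
      rw [Finset.sum_const, Finset.card_univ]
      simp only [Fintype.card_prod, Fintype.card_fin, nsmul_eq_mul]
      rw [pow_succ]
      apply le_of_eq
      push_cast
      ring

end TTree

/-! ### The law of the tree of a random Apollonian network -/

/-- Translates the choice of a face by its label into the label-free sum over grown shapes. -/
theorem LTree.sum_leaves_grow {U : LTree} (hU : U.WF) (v : ℕ) (φ : TTree → ℝ) :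
    ∑ S ∈ U.leaves, φ (U.grow v S).shape = U.shape.growSum φ := by
  induction U generalizing φ with
  | leaf T => simp [leaves, grow, shape, TTree.growSum]
  | node T c ih =>
    simp only [leaves, shape, TTree.growSum]
    rw [Finset.sum_biUnion]
    · refine Finset.sum_congr rfl fun i _ => ?_
      rw [← ih i (hU.2.2 i)]
      refine Finset.sum_congr rfl fun S hS => ?_
      refine congrArg φ ?_
      simp only [grow, shape]
      refine congrArg TTree.node ?_
      funext j
      by_cases hj : j = i
      · subst hj; simp
      · rw [Function.update_of_ne hj, grow_of_notMem fun h =>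
          Finset.disjoint_left.1 (hU.2.1 j i hj) (leaves_subset_labels _ h)
            (leaves_subset_labels _ hS)]
    · intro i _ j _ hij
      exact Finset.disjoint_of_subset_left (leaves_subset_labels _)
        (Finset.disjoint_of_subset_right (leaves_subset_labels _) (hU.2.1 i j hij))

theorem LTree.card_leaves {U : LTree} (hU : U.WF) :
    (U.leaves.card : ℝ) = 2 * U.shape.size + 1 := by
  rw [← TTree.growSum_one, ← LTree.sum_leaves_grow hU 0]
  simp

theorem sum_boundedFaces {f : ℕ → Finset ℕ} {t : ℕ} (hf : Valid f t) (φ : TTree → ℝ) :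
    ∑ S ∈ boundedFaces f t, ((boundedFaces f t).card : ℝ)⁻¹ *
      φ ((ltree f t).grow (t + 3) S).shape = TTree.avg φ (ltree f t).shape := by
  obtain ⟨h1, h2, -⟩ := ltree_spec hf
  rw [← h2, ← Finset.mul_sum, LTree.sum_leaves_grow h1, LTree.card_leaves h1, TTree.avg,
    div_eq_inv_mul]

theorem size_ltree {f : ℕ → Finset ℕ} {t : ℕ} (hf : Valid f t) :
    (ltree f t).shape.size = t := by
  induction t with
  | zero => rfl
  | succ t ih =>
    obtain ⟨hf, hft⟩ := valid_succ.1 hf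
    have key : ∀ U : LTree, U.WF → f t ∈ U.leaves →
        (U.grow (t + 3) (f t)).shape.size = U.shape.size + 1 := by
      intro U hU h
      induction U with
      | leaf T =>
        obtain rfl := Finset.mem_singleton.1 h
        simp [LTree.grow, LTree.shape, TTree.size]
      | node T c ih =>
        obtain ⟨i, -, hi⟩ := Finset.mem_biUnion.1 h
        have h1 : ∀ j ∈ Finset.univ.erase i, ((c j).grow (t + 3) (f t)).shape.size =
            (c j).shape.size := fun j hj => by
          rw [LTree.grow_of_notMem fun h => Finset.disjoint_left.1
            (hU.2.1 j i (Finset.ne_of_mem_erase hj)) (LTree.leaves_subset_labels _ h)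
              (LTree.leaves_subset_labels _ hi)]
        simp only [LTree.grow, LTree.shape, TTree.size]
        rw [← Finset.add_sum_erase _ _ (Finset.mem_univ i), Finset.sum_congr rfl h1,
          ih i (hU.2.2 i) hi, ← Finset.add_sum_erase _ (fun j => (c j).shape.size)
            (Finset.mem_univ i)]
        omega
    obtain ⟨h1, h2, -⟩ := ltree_spec hf
    rw [ltree, key _ h1 (h2 ▸ hft), ih hf]

theorem boundedFaces_nonempty {f : ℕ → Finset ℕ} {t : ℕ} (hf : Valid f t) :
    (boundedFaces f t).Nonempty := by
  obtain ⟨h1, h2, -⟩ := ltree_spec hf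
  have h := LTree.card_leaves h1
  rw [h2] at h
  rw [← Finset.card_pos]
  have : (0 : ℝ) < (boundedFaces f t).card := by rw [h]; positivity
  exact_mod_cast this

section Network

variable {Ω : Type*} [MeasurableSpace Ω] {P : Measure Ω} {F : ℕ → Ω → Finset ℕ}

theorem IsRandomApollonianNetwork.measurableSet_history (hF : IsRandomApollonianNetwork P F)
    (t : ℕ) (f : ℕ → Finset ℕ) : MeasurableSet {ω | ∀ s < t, F s ω = f s} := by
  simp only [Set.ofPred_forall]
  exact MeasurableSet.iInter fun s => MeasurableSet.iInter fun _ => hF.measurableSet_eq s (f s)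

variable [IsProbabilityMeasure P]

theorem IsRandomApollonianNetwork.measure_inter (hF : IsRandomApollonianNetwork P F)
    (t : ℕ) (f : ℕ → Finset ℕ) {T : Finset ℕ} (hT : T ∈ boundedFaces f t) :
    P ({ω | ∀ s < t, F s ω = f s} ∩ {ω | F t ω = T}) =
      P {ω | ∀ s < t, F s ω = f s} * ((boundedFaces f t).card : ENNReal)⁻¹ := by
  by_cases h0 : P {ω | ∀ s < t, F s ω = f s} = 0
  · rw [h0, zero_mul]
    exact measure_mono_null Set.inter_subset_left h0
  · have h := hF.cond_uniform t f h0 T hT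
    rw [cond_apply (hF.measurableSet_history t f)] at h
    rw [← h, ← mul_assoc, ENNReal.mul_inv_cancel h0 (measure_ne_top _ _), one_mul]

/-- The bounded faces, each with conditional probability one over their number, already exhaust the
probability of the history. -/
theorem IsRandomApollonianNetwork.measure_invalid (hF : IsRandomApollonianNetwork P F)
    (t : ℕ) {f : ℕ → Finset ℕ} (hf : Valid f t) :
    P ({ω | ∀ s < t, F s ω = f s} ∩ {ω | F t ω ∉ boundedFaces f t}) = 0 := by
  set C := {ω | ∀ s < t, F s ω = f s} with hC
  have hCm : MeasurableSet C := hF.measurableSet_history t f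
  set G := ⋃ T ∈ boundedFaces f t, C ∩ {ω | F t ω = T} with hG
  have hGm : MeasurableSet G := Finset.measurableSet_biUnion _ fun T _ =>
    hCm.inter (hF.measurableSet_eq t T)
  have hPG : P G = P C := by
    rw [hG, measure_biUnion_finset]
    · rw [Finset.sum_congr rfl fun T hT => hF.measure_inter t f hT, Finset.sum_const,
        nsmul_eq_mul, mul_comm, mul_assoc, ENNReal.inv_mul_cancel, mul_one]
      · simpa using (boundedFaces_nonempty hf).ne_empty
      · exact ENNReal.natCast_ne_top _
    · intro T _ T' _ hne
      refine Set.disjoint_left.2 fun ω h h' => hne ?_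
      rw [← show F t ω = T from h.2, ← show F t ω = T' from h'.2]
    · exact fun T _ => hCm.inter (hF.measurableSet_eq t T)
  have hGC : G ⊆ C := Set.iUnion₂_subset fun T _ => Set.inter_subset_left
  have : C ∩ {ω | F t ω ∉ boundedFaces f t} ⊆ C \ G := by
    rintro ω ⟨h1, h2⟩
    refine ⟨h1, fun h => h2 ?_⟩
    obtain ⟨T, hT, h⟩ := Set.mem_iUnion₂.1 h
    rwa [show F t ω = T from h.2]
  refine measure_mono_null this ?_
  rw [measure_sdiff hGC hGm.nullMeasurableSet (measure_ne_top _ _), hPG, tsub_self]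

/-- Induction on the number `k` of remaining steps, splitting on the next face; the sum over faces
is one application of `avg`. The event is an implication so that inadmissible histories count as
bad, and only monotonicity and subadditivity are applied to it, so its measurability is not needed.
-/
theorem IsRandomApollonianNetwork.measure_history_inter_le
    (hF : IsRandomApollonianNetwork P F) (B : Set TTree) (k t : ℕ) {f : ℕ → Finset ℕ}
    (hf : Valid f t) :
    P ({ω | ∀ s < t, F s ω = f s} ∩ {ω | Valid (fun s => F s ω) (t + k) →
        (ltree (fun s => F s ω) (t + k)).shape ∈ B}) ≤
      P {ω | ∀ s < t, F s ω = f s} *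
        ENNReal.ofReal (TTree.avg^[k] (B.indicator fun _ => 1) (ltree f t).shape) := by
  induction k generalizing t f with
  | zero =>
    by_cases h : (ltree f t).shape ∈ B
    · simp only [Function.iterate_zero, id, Set.indicator_of_mem h, ENNReal.ofReal_one, mul_one]
      exact measure_mono Set.inter_subset_left
    · have : {ω | ∀ s < t, F s ω = f s} ∩ {ω | Valid (fun s => F s ω) (t + 0) →
        (ltree (fun s => F s ω) (t + 0)).shape ∈ B} = ∅ := by
        refine Set.eq_empty_of_forall_notMem fun ω ⟨h1, h2⟩ => h ?_
        have h1' : ∀ s < t, f s = (fun s => F s ω) s := fun s hs => (h1 s hs).symm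
        rw [ltree_congr h1']
        exact h2 ((valid_congr h1').1 hf)
      rw [this, measure_empty]
      exact zero_le
  | succ k ih =>
    set C := {ω | ∀ s < t, F s ω = f s} with hC
    set E := {ω | Valid (fun s => F s ω) (t + (k + 1)) →
        (ltree (fun s => F s ω) (t + (k + 1))).shape ∈ B} with hE
    set φ := TTree.avg^[k] (B.indicator fun _ => (1 : ℝ)) with hφ
    have hφ0 : ∀ T, 0 ≤ φ T := by
      have : ∀ (k : ℕ) (ψ : TTree → ℝ), (∀ T, 0 ≤ ψ T) → ∀ T, 0 ≤ TTree.avg^[k] ψ T := by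
        intro k
        induction k with
        | zero => exact fun ψ h => h
        | succ k ih =>
          refine fun ψ h => ih _ fun T => div_nonneg ?_ (by positivity)
          have := TTree.growSum_mono (T := T) (φ := fun _ => 0 * 1) (ψ := ψ)
            fun d _ => by simpa using h d
          rwa [TTree.growSum_const_mul, zero_mul] at this
      exact this k _ fun T => Set.indicator_nonneg (fun _ _ => zero_le_one) T
    have hstep : ∀ T ∈ boundedFaces f t, P ((C ∩ {ω | F t ω = T}) ∩ E) ≤
        P C * ENNReal.ofReal (((boundedFaces f t).card : ℝ)⁻¹ *
          φ ((ltree f t).grow (t + 3) T).shape) := by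
      intro T hT
      set g := Function.update f t T with hg
      have hgf : ∀ s < t, g s = f s := fun s hs => Function.update_of_ne hs.ne _ _
      have hgt : g t = T := Function.update_self _ _ _
      have hgv : Valid g (t + 1) :=
        valid_succ.2 ⟨(valid_congr hgf).2 hf, by rwa [hgt, boundedFaces_congr hgf]⟩
      have hCT : C ∩ {ω | F t ω = T} = {ω | ∀ s < t + 1, F s ω = g s} := by
        ext ω
        simp only [hC, Set.mem_inter_iff, Set.mem_ofPred_eq]
        constructor
        · rintro ⟨h1, h2⟩ s hs
          rcases Nat.lt_succ_iff_lt_or_eq.1 hs with h | rfl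
          · rw [hgf s h, h1 s h]
          · rw [hgt, h2]
        · intro h
          exact ⟨fun s hs => by rw [h s (by omega), hgf s hs], by rw [h t (by omega), hgt]⟩
      have hind := ih (t + 1) hgv
      rw [← hCT, hF.measure_inter t f hT, show t + 1 + k = t + (k + 1) by ring, ltree,
        ltree_congr hgf, hgt] at hind
      refine hind.trans ?_
      rw [mul_assoc, ENNReal.ofReal_mul (by positivity), ENNReal.ofReal_inv_of_pos,
        ENNReal.ofReal_natCast]
      exact_mod_cast (boundedFaces_nonempty hf).card_pos
    have hcov : C ∩ E ⊆ (⋃ T ∈ boundedFaces f t, (C ∩ {ω | F t ω = T}) ∩ E) ∪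
        (C ∩ {ω | F t ω ∉ boundedFaces f t}) := by
      rintro ω ⟨h1, h2⟩
      by_cases h : F t ω ∈ boundedFaces f t
      · exact .inl (Set.mem_iUnion₂.2 ⟨F t ω, h, ⟨h1, rfl⟩, h2⟩)
      · exact .inr ⟨h1, h⟩
    calc P (C ∩ E) ≤ P (⋃ T ∈ boundedFaces f t, (C ∩ {ω | F t ω = T}) ∩ E) + 0 := by
          rw [← hF.measure_invalid t hf]
          exact (measure_mono hcov).trans (measure_union_le _ _)
      _ ≤ ∑ T ∈ boundedFaces f t, P ((C ∩ {ω | F t ω = T}) ∩ E) := by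
          rw [add_zero]
          exact measure_biUnion_finset_le _ _
      _ ≤ ∑ T ∈ boundedFaces f t, P C * ENNReal.ofReal (((boundedFaces f t).card : ℝ)⁻¹ *
          φ ((ltree f t).grow (t + 3) T).shape) := Finset.sum_le_sum hstep
      _ = P C * ENNReal.ofReal (TTree.avg φ (ltree f t).shape) := by
          rw [← Finset.mul_sum, ← ENNReal.ofReal_sum_of_nonneg, sum_boundedFaces hf]
          exact fun T _ => mul_nonneg (by positivity) (hφ0 _)
      _ = _ := by rw [Function.iterate_succ_apply']

/-- The probability that the history is not admissible or the shape of the triangle-tree lies in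
`B` is at most the mass that the law of the growing tree gives to `B`. -/
theorem IsRandomApollonianNetwork.measure_shape_le (hF : IsRandomApollonianNetwork P F)
    (B : Set TTree) (t : ℕ) :
    P {ω | Valid (fun s => F s ω) t → (ltree (fun s => F s ω) t).shape ∈ B} ≤
      ENNReal.ofReal (TTree.law t (B.indicator fun _ => 1)) := by
  have h := hF.measure_history_inter_le B t 0 (f := fun _ => ∅)
    (fun s hs => absurd hs (Nat.not_lt_zero s))
  have h0 : {ω | ∀ s < 0, F s ω = (fun _ => ∅ : ℕ → Finset ℕ) s} = Set.univ :=
    Set.eq_univ_of_forall fun ω s hs => absurd hs (Nat.not_lt_zero s)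
  rw [h0, Set.univ_inter, measure_univ, one_mul, zero_add] at h
  exact h

end Network

/-! ### Moments of the Dirichlet distribution -/

theorem measurable_snoc_simplex {n : ℕ} :
    Measurable fun x : Fin n → ℝ => (Fin.snoc x (1 - ∑ i, x i) : Fin (n + 1) → ℝ) := by
  refine measurable_pi_iff.2 fun j => ?_
  refine Fin.lastCases ?_ (fun i => ?_) j
  · simp only [Fin.snoc_last]
    fun_prop
  · simp only [Fin.snoc_castSucc]
    fun_prop

theorem measurable_dirichletDensity {n : ℕ} (α : Fin (n + 1) → ℝ) :
    Measurable (dirichletDensity α) := by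
  unfold dirichletDensity
  refine Measurable.ite ?_ ?_ measurable_const
  · refine MeasurableSet.inter (s₁ := {x : Fin n → ℝ | ∀ i, 0 < x i})
      (s₂ := {x : Fin n → ℝ | ∑ i, x i < 1}) ?_ ?_
    · simp only [Set.ofPred_forall]
      exact MeasurableSet.iInter fun i => measurableSet_lt measurable_const (measurable_pi_apply i)
    · exact measurableSet_lt (by fun_prop) measurable_const
  · refine measurable_const.mul (Finset.measurable_prod _ fun j _ => ?_)
    exact ((measurable_pi_apply j).comp measurable_snoc_simplex).pow_const _

theorem dirichletDensity_nonneg {n : ℕ} {α : Fin (n + 1) → ℝ} (hα : ∀ i, 0 < α i)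
    (x : Fin n → ℝ) : 0 ≤ dirichletDensity α x := by
  unfold dirichletDensity
  split_ifs with h
  · refine mul_nonneg (div_nonneg (Real.Gamma_nonneg_of_nonneg ?_) ?_) ?_
    · exact Finset.sum_nonneg fun i _ => (hα i).le
    · exact Finset.prod_nonneg fun i _ => Real.Gamma_nonneg_of_nonneg (hα i).le
    · rw [Fin.prod_univ_castSucc]
      simp only [Fin.snoc_castSucc, Fin.snoc_last]
      exact mul_nonneg (Finset.prod_nonneg fun i _ => Real.rpow_nonneg (h.1 i).le _)
        (Real.rpow_nonneg (by linarith [h.2]) _)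
  · exact le_rfl

/-- Stick breaking: the first coordinate and the relative share `u` of the second in the remainder
are independent Beta variables. The factor `1 - x` is the Jacobian of `u ↦ (1 - x) * u`. -/
theorem dirichletDensity_scaled {α : Fin 3 → ℝ} (hα : ∀ i, 0 < α i) {x : ℝ} (hx : 0 < x)
    (hx1 : x < 1) (u : ℝ) :
    (1 - x) * dirichletDensity α ![x, (1 - x) * u] =
      betaPDFReal (α 0) (α 1 + α 2) x * betaPDFReal (α 1) (α 2) u := by
  have h1x : 0 < 1 - x := by linarith
  unfold dirichletDensity betaPDFReal
  by_cases hu : 0 < u ∧ u < 1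
  · have hs : (∀ i : Fin 2, 0 < ![x, (1 - x) * u] i) ∧ ∑ i, ![x, (1 - x) * u] i < 1 := by
      constructor
      · intro i
        fin_cases i
        · exact hx
        · exact mul_pos h1x hu.1
      · simp only [Fin.sum_univ_two, Matrix.cons_val_zero, Matrix.cons_val_one]
        nlinarith [hu.2]
    rw [if_pos hs, if_pos ⟨hx, hx1⟩, if_pos hu]
    have e0 : (Fin.snoc ![x, (1 - x) * u] (1 - ∑ i, ![x, (1 - x) * u] i) : Fin 3 → ℝ) 0 = x := rfl
    have e1 : (Fin.snoc ![x, (1 - x) * u] (1 - ∑ i, ![x, (1 - x) * u] i) : Fin 3 → ℝ) 1 =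
      (1 - x) * u := rfl
    have e2 : (Fin.snoc ![x, (1 - x) * u] (1 - ∑ i, ![x, (1 - x) * u] i) : Fin 3 → ℝ) 2 =
        (1 - x) * (1 - u) := by
      refine (Fin.snoc_last (α := fun _ => ℝ) (n := 2) _ _).trans ?_
      simp only [Fin.sum_univ_two, Matrix.cons_val_zero, Matrix.cons_val_one]
      ring
    have h1u : 0 < 1 - u := by linarith [hu.2]
    rw [Fin.prod_univ_three, Fin.prod_univ_three, Fin.sum_univ_three, e0, e1, e2,
      Real.mul_rpow h1x.le hu.1.le, Real.mul_rpow h1x.le h1u.le]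
    have hpow : (1 - x) ^ (α 1 + α 2 - 1) =
        (1 - x) * ((1 - x) ^ (α 1 - 1) * (1 - x) ^ (α 2 - 1)) := by
      rw [← Real.rpow_add h1x]
      nth_rewrite 2 [← Real.rpow_one (1 - x)]
      rw [← Real.rpow_add h1x]
      congr 1
      ring
    rw [hpow]
    have g0 := (Real.Gamma_pos_of_pos (hα 0)).ne'
    have g1 := (Real.Gamma_pos_of_pos (hα 1)).ne'
    have g2 := (Real.Gamma_pos_of_pos (hα 2)).ne'
    have g3 := (Real.Gamma_pos_of_pos (add_pos (hα 1) (hα 2))).ne'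
    have g4 := (Real.Gamma_pos_of_pos (add_pos (hα 0) (add_pos (hα 1) (hα 2)))).ne'
    simp only [beta]
    rw [add_assoc]
    field_simp
  · rw [if_neg (c := 0 < u ∧ u < 1) hu, if_neg, mul_zero, mul_zero]
    rintro ⟨h0, h1⟩
    refine hu ⟨?_, ?_⟩
    · have := h0 1
      simp only [Matrix.cons_val_one] at this
      exact pos_of_mul_pos_right this h1x.le
    · simp only [Fin.sum_univ_two, Matrix.cons_val_zero, Matrix.cons_val_one] at h1
      by_contra hcon
      nlinarith

theorem lintegral_dirichletDensity {α : Fin 3 → ℝ} (hα : ∀ i, 0 < α i) :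
    ∫⁻ x, ENNReal.ofReal (dirichletDensity (n := 2) α x) = 1 := by
  have hm : Measurable fun x : Fin 2 → ℝ => ENNReal.ofReal (dirichletDensity (n := 2) α x) :=
    (measurable_dirichletDensity α).ennreal_ofReal
  rw [← (volume_preserving_finTwoArrow ℝ).symm.lintegral_comp_emb
    (MeasurableEquiv.finTwoArrow (α := ℝ)).symm.measurableEmbedding]
  have hm2 : Measurable fun z : ℝ × ℝ => ENNReal.ofReal (dirichletDensity (n := 2) α
      ((MeasurableEquiv.finTwoArrow (α := ℝ)).symm z)) :=
    hm.comp (MeasurableEquiv.finTwoArrow (α := ℝ)).symm.measurable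
  rw [Measure.volume_eq_prod, lintegral_prod _ hm2.aemeasurable]
  rw [← lintegral_betaPDF_eq_one (hα 0) (add_pos (hα 1) (hα 2))]
  refine lintegral_congr fun x => ?_
  have hcoe : ∀ y, (MeasurableEquiv.finTwoArrow (α := ℝ)).symm (x, y) = ![x, y] := fun y => rfl
  simp only [hcoe]
  by_cases hx : 0 < x ∧ x < 1
  · have h1x : 0 < 1 - x := by linarith [hx.2]
    have hmx : Measurable fun y : ℝ => ENNReal.ofReal (dirichletDensity (n := 2) α ![x, y]) :=
      hm.comp (by
        refine measurable_pi_iff.2 fun i => ?_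
        fin_cases i
        · exact measurable_const
        · exact measurable_id)
    have hmc : Measurable fun u : ℝ =>
        ENNReal.ofReal (dirichletDensity (n := 2) α ![x, (1 - x) * u]) :=
      hmx.comp (measurable_const_mul _)
    rw [← Real.smul_map_volume_mul_left h1x.ne', lintegral_smul_measure,
      lintegral_map hmx (measurable_const_mul _), abs_of_pos h1x, smul_eq_mul,
      ← lintegral_const_mul _ hmc]
    have : ∀ u, ENNReal.ofReal (1 - x) *
        ENNReal.ofReal (dirichletDensity (n := 2) α ![x, (1 - x) * u]) =
        betaPDF (α 0) (α 1 + α 2) x * betaPDF (α 1) (α 2) u := fun u => by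
      rw [← ENNReal.ofReal_mul h1x.le, dirichletDensity_scaled hα hx.1 hx.2, betaPDF, betaPDF,
        ENNReal.ofReal_mul]
      exact (betaPDFReal_pos hx.1 hx.2 (hα 0) (add_pos (hα 1) (hα 2))).le
    simp only [this]
    have hb : Measurable (betaPDF (α 1) (α 2)) := (measurable_betaPDFReal _ _).ennreal_ofReal
    rw [lintegral_const_mul _ hb,
      lintegral_betaPDF_eq_one (hα 1) (hα 2), mul_one]
  · have h0 : betaPDF (α 0) (α 1 + α 2) x = 0 := by
      rw [betaPDF_eq, if_neg hx, ENNReal.ofReal_zero]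
    rw [h0]
    have : ∀ y, dirichletDensity (n := 2) α ![x, y] = 0 := fun y => by
      unfold dirichletDensity
      rw [if_neg]
      rintro ⟨h1, h2⟩
      have a1 := h1 0
      have a2 := h1 1
      simp only [Fin.sum_univ_two, Matrix.cons_val_zero, Matrix.cons_val_one] at a1 a2 h2
      exact hx ⟨a1, by linarith⟩
    simp [this]

theorem isProbabilityMeasure_dirichlet {α : Fin 3 → ℝ} (hα : ∀ i, 0 < α i) :
    IsProbabilityMeasure (dirichlet (n := 2) α) := by
  refine ⟨?_⟩
  rw [dirichlet, Measure.map_apply measurable_snoc_simplex MeasurableSet.univ, Set.preimage_univ,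
    withDensity_apply _ MeasurableSet.univ, Measure.restrict_univ, lintegral_dirichletDensity hα]

theorem dirichlet_ae_simplex {α : Fin 3 → ℝ} :
    ∀ᵐ v ∂dirichlet (n := 2) α, (∀ i, 0 ≤ v i) ∧ ∑ i, v i = 1 := by
  have hms : MeasurableSet {v : Fin 3 → ℝ | (∀ i, 0 ≤ v i) ∧ ∑ i, v i = 1} := by
    refine MeasurableSet.inter (s₁ := {v : Fin 3 → ℝ | ∀ i, 0 ≤ v i})
      (s₂ := {v : Fin 3 → ℝ | ∑ i, v i = 1}) ?_ ?_
    · simp only [Set.ofPred_forall]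
      exact MeasurableSet.iInter fun i => measurableSet_le measurable_const (measurable_pi_apply i)
    · exact measurableSet_eq_fun (by fun_prop) measurable_const
  rw [dirichlet, ae_map_iff measurable_snoc_simplex.aemeasurable hms,
    ae_withDensity_iff (measurable_dirichletDensity α).ennreal_ofReal]
  refine Eventually.of_forall fun x hx => ?_
  have hs : (∀ i, 0 < x i) ∧ ∑ i, x i < 1 := by
    by_contra hs
    exact hx (by rw [dirichletDensity, if_neg hs, ENNReal.ofReal_zero])
  refine ⟨fun i => ?_, ?_⟩
  · refine Fin.lastCases ?_ (fun j => ?_) i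
    · simp only [Fin.snoc_last]
      linarith [hs.2]
    · simp only [Fin.snoc_castSucc]
      exact (hs.1 j).le
  · rw [Fin.sum_univ_castSucc]
    simp only [Fin.snoc_castSucc, Fin.snoc_last]
    ring

/-- A monomial only shifts the Dirichlet parameters, so moments are quotients of normalizing
constants. -/
theorem dirichletDensity_mul_monomial {α : Fin 3 → ℝ} (hα : ∀ i, 0 < α i) (a : Fin 3 → ℕ)
    (x : Fin 2 → ℝ) :
    dirichletDensity α x * ∏ j, (Fin.snoc x (1 - ∑ i, x i) : Fin 3 → ℝ) j ^ a j =
      Real.Gamma (∑ i, α i) / (∏ i, Real.Gamma (α i)) *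
        ((∏ i, Real.Gamma (α i + a i)) / Real.Gamma (∑ i, (α i + a i))) *
          dirichletDensity (fun i => α i + a i) x := by
  unfold dirichletDensity
  split_ifs with h
  · have hpos : ∀ j, 0 < (Fin.snoc x (1 - ∑ i, x i) : Fin 3 → ℝ) j := by
      intro j
      refine Fin.lastCases ?_ (fun i => ?_) j
      · simp only [Fin.snoc_last]
        linarith [h.2]
      · simp only [Fin.snoc_castSucc]
        exact h.1 i
    have hprod : ∏ j, (Fin.snoc x (1 - ∑ i, x i) : Fin 3 → ℝ) j ^ (α j + a j - 1) =
        (∏ j, (Fin.snoc x (1 - ∑ i, x i) : Fin 3 → ℝ) j ^ (α j - 1)) *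
          ∏ j, (Fin.snoc x (1 - ∑ i, x i) : Fin 3 → ℝ) j ^ a j := by
      rw [← Finset.prod_mul_distrib]
      refine Finset.prod_congr rfl fun j _ => ?_
      rw [← Real.rpow_natCast, ← Real.rpow_add (hpos j)]
      congr 1
      ring
    rw [hprod]
    have g1 : (∏ i, Real.Gamma (α i + a i)) ≠ 0 := Finset.prod_ne_zero_iff.2 fun i _ =>
      (Real.Gamma_pos_of_pos (add_pos_of_pos_of_nonneg (hα i) (Nat.cast_nonneg _))).ne'
    have g2 : Real.Gamma (∑ i, (α i + a i)) ≠ 0 := (Real.Gamma_pos_of_pos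
      (Finset.sum_pos (fun i _ => add_pos_of_pos_of_nonneg (hα i) (Nat.cast_nonneg _))
        Finset.univ_nonempty)).ne'
    field_simp
  · simp

theorem integral_monomial_dirichlet {α : Fin 3 → ℝ} (hα : ∀ i, 0 < α i) (a : Fin 3 → ℕ) :
    ∫ v, ∏ j, v j ^ a j ∂dirichlet (n := 2) α =
      Real.Gamma (∑ i, α i) / (∏ i, Real.Gamma (α i)) *
        ((∏ i, Real.Gamma (α i + a i)) / Real.Gamma (∑ i, (α i + a i))) := by
  have hαa : ∀ i, 0 < α i + a i := fun i => add_pos_of_pos_of_nonneg (hα i) (Nat.cast_nonneg _)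
  rw [dirichlet, integral_map measurable_snoc_simplex.aemeasurable
    (Measurable.aestronglyMeasurable (by fun_prop)),
    integral_withDensity_eq_integral_toReal_smul
      (measurable_dirichletDensity α).ennreal_ofReal (by simp)]
  simp only [ENNReal.toReal_ofReal (dirichletDensity_nonneg hα _), smul_eq_mul]
  simp only [dirichletDensity_mul_monomial hα a]
  rw [integral_const_mul, integral_eq_lintegral_of_nonneg_ae
    (Eventually.of_forall fun x => dirichletDensity_nonneg hαa x)
    (measurable_dirichletDensity _).aestronglyMeasurable, lintegral_dirichletDensity hαa]
  simp

/-- The Dirichlet(1/2, 1/2, 1/2) distribution. -/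
abbrev dir : Measure (Fin 3 → ℝ) := dirichlet (n := 2) fun _ => 1 / 2

instance : IsProbabilityMeasure dir := isProbabilityMeasure_dirichlet fun _ => by norm_num

theorem integral_monomial_dir_zero : ∫ v, ∏ j, v j ^ (0 : Fin 3 → ℕ) j ∂dir = 1 := by simp

/-- By the Gamma recursion consecutive moments have quotient `(a i + 1/2) / (∑ a + 3/2)`, exactly
the transition probability of `urn`. This is where the parameter `1/2` comes from. -/
theorem integral_monomial_dir_succ (a : Fin 3 → ℕ) (i : Fin 3) :
    ∫ v, ∏ j, v j ^ (a + Pi.single i 1 : Fin 3 → ℕ) j ∂dir =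
      (∫ v, ∏ j, v j ^ a j ∂dir) *
        ((2 * (a i : ℝ) + 1) / (2 * ∑ j, (a j : ℝ) + 3)) := by
  rw [integral_monomial_dirichlet (fun _ => by norm_num),
    integral_monomial_dirichlet (fun _ => by norm_num)]
  have h1 : ∏ j, Real.Gamma (1 / 2 + ((a + Pi.single i 1 : Fin 3 → ℕ) j : ℕ)) =
      (1 / 2 + a i) * ∏ j, Real.Gamma (1 / 2 + (a j : ℝ)) := by
    rw [← Finset.mul_prod_erase _ _ (Finset.mem_univ i),
      ← Finset.mul_prod_erase _ (fun j => Real.Gamma (1 / 2 + (a j : ℝ))) (Finset.mem_univ i),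
      ← mul_assoc]
    congr 1
    · simp only [Pi.add_apply, Pi.single_eq_same, Nat.cast_add, Nat.cast_one]
      rw [← add_assoc, Real.Gamma_add_one (by positivity)]
    · refine Finset.prod_congr rfl fun j hj => ?_
      simp [Pi.single_eq_of_ne (Finset.ne_of_mem_erase hj)]
  have h2 : Real.Gamma (∑ j, (1 / 2 + ((a + Pi.single i 1 : Fin 3 → ℕ) j : ℕ) : ℝ)) =
      (∑ j, (1 / 2 + (a j : ℝ))) * Real.Gamma (∑ j, (1 / 2 + (a j : ℝ))) := by
    rw [← Real.Gamma_add_one (by positivity)]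
    congr 1
    simp only [Pi.add_apply, Nat.cast_add, ← add_assoc]
    rw [Finset.sum_add_distrib]
    congr 1
    rw [← Nat.cast_sum]
    simp
  have h3 : ∑ j, (1 / 2 + (a j : ℝ)) = (2 * ∑ j, (a j : ℝ) + 3) / 2 := by
    rw [Finset.sum_add_distrib]
    simp
    ring
  rw [h1, h2, h3]
  have g2 : Real.Gamma ((2 * ∑ j, (a j : ℝ) + 3) / 2) ≠ 0 :=
    (Real.Gamma_pos_of_pos (by positivity)).ne'
  have g3 : (2 * ∑ j, (a j : ℝ) + 3) ≠ 0 := by positivity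
  field_simp
  ring

/-! ### The urn as a mixture of independent draws -/

/-- The mean of `g` after a ball with colour distribution `x` has been added to the state `a`. -/
def draw (x : Fin 3 → ℝ) (g : (Fin 3 → ℕ) → ℝ) (a : Fin 3 → ℕ) : ℝ :=
  ∑ i, x i * g (a + Pi.single i 1)

theorem continuous_draw_iterate (m : ℕ) (g : (Fin 3 → ℕ) → ℝ) (a : Fin 3 → ℕ) :
    Continuous fun x => (draw x)^[m] g a := by
  induction m generalizing a with
  | zero => exact continuous_const
  | succ m ih =>
    simp only [Function.iterate_succ_apply']
    exact continuous_finsetSum _ fun i _ => (continuous_apply i).mul (ih _)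

theorem draw_sum {ι : Type*} (s : Finset ι) (x : Fin 3 → ℝ) (g : ι → (Fin 3 → ℕ) → ℝ) :
    draw x (fun a => ∑ i ∈ s, g i a) = fun a => ∑ i ∈ s, draw x (g i) a := by
  funext a
  simp only [draw, Finset.mul_sum]
  exact Finset.sum_comm

theorem draw_iterate_sum {ι : Type*} (s : Finset ι) (x : Fin 3 → ℝ) (m : ℕ)
    (g : ι → (Fin 3 → ℕ) → ℝ) (a : Fin 3 → ℕ) :
    (draw x)^[m] (fun a => ∑ i ∈ s, g i a) a = ∑ i ∈ s, (draw x)^[m] (g i) a := by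
  induction m generalizing g with
  | zero => rfl
  | succ m ih => rw [Function.iterate_succ_apply, draw_sum, ih]; rfl

theorem draw_iterate_mul_const (x : Fin 3 → ℝ) (m : ℕ) (c : ℝ) (g : (Fin 3 → ℕ) → ℝ)
    (a : Fin 3 → ℕ) : (draw x)^[m] (fun a => g a * c) a = (draw x)^[m] g a * c := by
  induction m generalizing g with
  | zero => rfl
  | succ m ih =>
    rw [Function.iterate_succ_apply, show draw x (fun a => g a * c) = fun a => draw x g a * c by
      funext a; simp only [draw, Finset.sum_mul, mul_assoc], ih]
    rfl

theorem draw_iterate_add (x : Fin 3 → ℝ) (m : ℕ) (g h : (Fin 3 → ℕ) → ℝ)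
    (a : Fin 3 → ℕ) :
    (draw x)^[m] (fun a => g a + h a) a = (draw x)^[m] g a + (draw x)^[m] h a := by
  have := draw_iterate_sum Finset.univ x m ![g, h] a
  simpa [Fin.sum_univ_two] using this

theorem draw_iterate_const {x : Fin 3 → ℝ} (hx : ∑ i, x i = 1) (m : ℕ) (c : ℝ)
    (a : Fin 3 → ℕ) : (draw x)^[m] (fun _ => c) a = c := by
  induction m with
  | zero => rfl
  | succ m ih =>
    rw [Function.iterate_succ_apply, show draw x (fun _ => c) = fun _ => c by
      funext a; simp only [draw, ← Finset.sum_mul, hx, one_mul], ih]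

theorem draw_iterate_congr {x : Fin 3 → ℝ} {m : ℕ} {g h : (Fin 3 → ℕ) → ℝ} {a : Fin 3 → ℕ}
    (H : ∀ b, ∑ i, b i = (∑ i, a i) + m → g b = h b) : (draw x)^[m] g a = (draw x)^[m] h a := by
  induction m generalizing g h with
  | zero => exact H a rfl
  | succ m ih =>
    refine ih fun b hb => Finset.sum_congr rfl fun i _ => ?_
    rw [H]
    simp only [Pi.add_apply, Finset.sum_add_distrib, hb, Finset.sum_pi_single', Finset.mem_univ,
      if_true]
    omega

theorem draw_iterate_mono {x : Fin 3 → ℝ} (hx : ∀ i, 0 ≤ x i) {m : ℕ}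
    {g h : (Fin 3 → ℕ) → ℝ} {a : Fin 3 → ℕ}
    (H : ∀ b, ∑ i, b i = (∑ i, a i) + m → g b ≤ h b) : (draw x)^[m] g a ≤ (draw x)^[m] h a := by
  induction m generalizing g h with
  | zero => exact H a rfl
  | succ m ih =>
    refine ih fun b hb => Finset.sum_le_sum fun i _ => mul_le_mul_of_nonneg_left (H _ ?_) (hx i)
    simp only [Pi.add_apply, Finset.sum_add_distrib, hb, Finset.sum_pi_single', Finset.mem_univ,
      if_true]
    omega

/-- Squared bias plus binomial variance. -/
theorem draw_iterate_sq {x : Fin 3 → ℝ} (hx : ∑ i, x i = 1) (m : ℕ) (j : Fin 3) (z : ℝ)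
    (a : Fin 3 → ℕ) :
    (draw x)^[m] (fun b => ((b j : ℝ) - z) ^ 2) a =
      (a j + m * x j - z) ^ 2 + m * (x j * (1 - x j)) := by
  induction m generalizing a with
  | zero => simp
  | succ m ih =>
    rw [Function.iterate_succ_apply', draw]
    simp only [ih]
    rw [← Finset.add_sum_erase _ _ (Finset.mem_univ j)]
    have h1 : ∀ i ∈ Finset.univ.erase j, x i * ((((a + Pi.single i 1 : Fin 3 → ℕ) j : ℕ) +
        m * x j - z) ^ 2 + m * (x j * (1 - x j))) =
        x i * ((a j + m * x j - z) ^ 2 + m * (x j * (1 - x j))) := fun i hi => by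
      simp [Pi.single_eq_of_ne (Finset.ne_of_mem_erase hi).symm]
    have h2 : ∑ i ∈ Finset.univ.erase j, x i = 1 - x j := by
      rw [← hx, ← Finset.add_sum_erase _ _ (Finset.mem_univ j), add_sub_cancel_left]
    rw [Finset.sum_congr rfl h1, ← Finset.sum_mul, h2]
    simp only [Pi.add_apply, Pi.single_eq_same]
    push_cast
    ring

theorem ae_dir_mem_Icc : ∀ᵐ v ∂dir, v ∈ Set.Icc (0 : Fin 3 → ℝ) 1 := by
  filter_upwards [dirichlet_ae_simplex] with v hv
  refine ⟨fun i => hv.1 i, fun i => ?_⟩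
  rw [Pi.one_apply, ← hv.2]
  exact Finset.single_le_sum (fun j _ => hv.1 j) (Finset.mem_univ i)

theorem integrable_dir {g : (Fin 3 → ℝ) → ℝ} (hg : Continuous g) : Integrable g dir := by
  obtain ⟨C, hC⟩ := isCompact_Icc.exists_bound_of_continuousOn (s := Set.Icc (0 : Fin 3 → ℝ) 1)
    hg.continuousOn
  refine Integrable.of_bound hg.aestronglyMeasurable C ?_
  filter_upwards [ae_dir_mem_Icc] with v hv
  exact hC v hv

/-- The urn process is a mixture of processes with independent draws. -/
theorem urn_iterate_eq_integral (m : ℕ) (g : (Fin 3 → ℕ) → ℝ) :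
    TTree.urn^[m] g 0 = ∫ v, (draw v)^[m] g 0 ∂dir := by
  -- Induction needs an arbitrary initial state: starting from `a`, the mixing law is reweighted by
  -- the monomial with exponents `a`.
  have key : ∀ (m : ℕ) (a : Fin 3 → ℕ), (∫ v, ∏ j, v j ^ a j ∂dir) * TTree.urn^[m] g a =
      ∫ v, (∏ j, v j ^ a j) * (draw v)^[m] g a ∂dir := by
    intro m
    induction m with
    | zero => exact fun a => (integral_mul_const _ _).symm
    | succ m ih =>
      intro a
      have hsum : ∀ v : Fin 3 → ℝ, (∏ j, v j ^ a j) * (draw v)^[m + 1] g a =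
          ∑ i, (∏ j, v j ^ a j) * (v i * (draw v)^[m] g (a + Pi.single i 1)) := fun v => by
        rw [Function.iterate_succ_apply', draw, Finset.mul_sum]
      simp only [hsum]
      rw [Function.iterate_succ_apply', TTree.urn, Finset.mul_sum]
      have hcont : ∀ b : Fin 3 → ℕ, Continuous fun v : Fin 3 → ℝ => ∏ j, v j ^ b j :=
        fun b => by fun_prop
      rw [integral_finsetSum]
      · refine Finset.sum_congr rfl fun i _ => ?_
        rw [← mul_assoc, ← integral_monomial_dir_succ, ih]
        refine integral_congr_ae (Eventually.of_forall fun v => ?_)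
        simp only [← mul_assoc]
        congr 1
        rw [← Finset.mul_prod_erase _ _ (Finset.mem_univ i),
          ← Finset.mul_prod_erase _ (fun j => v j ^ a j) (Finset.mem_univ i)]
        have : ∏ j ∈ Finset.univ.erase i, v j ^ (a + Pi.single i 1 : Fin 3 → ℕ) j =
            ∏ j ∈ Finset.univ.erase i, v j ^ a j := Finset.prod_congr rfl fun j hj => by
          simp [Pi.single_eq_of_ne (Finset.ne_of_mem_erase hj)]
        rw [this]
        simp only [Pi.add_apply, Pi.single_eq_same, pow_succ]
        ring
      · exact fun i _ => integrable_dir ((hcont a).mul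
          ((continuous_apply i).mul (continuous_draw_iterate m g _)))
  have h := key m 0
  rw [integral_monomial_dir_zero, one_mul] at h
  simpa using h

/-- The mean of `h` over the sizes of the branches of a tree of size `s` if the vertices below the
root choose their branch independently with distribution `x`. -/
def indepSplit (x : Fin 3 → ℝ) (s : ℕ) (h : (Fin 3 → ℕ) → ℝ) : ℝ := (draw x)^[s - 1] h 0

/-- The root is one of the `s` internal nodes, leaving `s - 1` draws; truncated subtraction covers
the leaf. -/
theorem split_eq_urn (s : ℕ) (h : (Fin 3 → ℕ) → ℝ) :
    TTree.split s h = TTree.urn^[s - 1] h 0 := by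
  cases s with
  | zero => exact TTree.split_zero h
  | succ m => exact TTree.split_succ m h

theorem split_eq_integral (s : ℕ) (h : (Fin 3 → ℕ) → ℝ) :
    TTree.split s h = ∫ v, indepSplit v s h ∂dir := by
  rw [split_eq_urn, urn_iterate_eq_integral]
  rfl

theorem continuous_indepSplit (s : ℕ) (h : (Fin 3 → ℕ) → ℝ) :
    Continuous fun x => indepSplit x s h := continuous_draw_iterate _ _ _

/-- A finite set that contains all possible sizes of the branches of a tree of size `s`. -/
def sizeBox (s : ℕ) : Finset (Fin 3 → ℕ) := Fintype.piFinset fun _ => Finset.range (s + 1)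

theorem mem_sizeBox {s : ℕ} {b : Fin 3 → ℕ} (hb : ∑ i, b i ≤ s) : b ∈ sizeBox s := by
  refine Fintype.mem_piFinset.2 fun i => ?_
  have := Finset.single_le_sum (f := b) (fun j _ => Nat.zero_le _) (Finset.mem_univ i)
  simp only [Finset.mem_range]
  omega

/-- The probability that the sizes of the branches are `b`. -/
def splitWeight (x : Fin 3 → ℝ) (s : ℕ) (b : Fin 3 → ℕ) : ℝ := indepSplit x s (Pi.single b 1)

theorem continuous_splitWeight (s : ℕ) (b : Fin 3 → ℕ) :
    Continuous fun x => splitWeight x s b := continuous_indepSplit _ _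

/-- Only finitely many size vectors occur, so nested means become finite sums whose coefficients are
continuous in `x`. -/
theorem indepSplit_eq_sum (x : Fin 3 → ℝ) (s : ℕ) (h : (Fin 3 → ℕ) → ℝ) :
    indepSplit x s h = ∑ b ∈ sizeBox s, splitWeight x s b * h b := by
  simp only [splitWeight, indepSplit, ← draw_iterate_mul_const]
  rw [← draw_iterate_sum]
  refine draw_iterate_congr fun b hb => ?_
  rw [Finset.sum_eq_single b]
  · simp
  · intro c _ hcb
    simp [Pi.single_eq_of_ne hcb.symm]
  · intro hb'
    refine absurd (mem_sizeBox ?_) hb'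
    simp only [Pi.zero_apply, Finset.sum_const_zero] at hb
    omega

theorem split_eq_sum (s : ℕ) (h : (Fin 3 → ℕ) → ℝ) :
    TTree.split s h = ∑ b ∈ sizeBox s, (∫ v, splitWeight v s b ∂dir) * h b := by
  rw [split_eq_integral]
  simp only [indepSplit_eq_sum _ s h]
  rw [integral_finsetSum]
  · exact Finset.sum_congr rfl fun b _ => integral_mul_const _ _
  · exact fun b _ => integrable_dir ((continuous_splitWeight s _).mul continuous_const)

/-! ### The nine branch sizes as a mixture over four independent Dirichlet vectors. -/

instance : IsProbabilityMeasure fourDirichlet :=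
  inferInstanceAs (IsProbabilityMeasure (Measure.pi fun _ : Fin 4 => dir))

theorem fourDirichlet_ae_simplex :
    ∀ᵐ v ∂fourDirichlet, ∀ k, (∀ i, 0 ≤ v k i) ∧ ∑ i, v k i = 1 := by
  rw [ae_all_iff]
  intro k
  exact (measurePreserving_eval (fun _ : Fin 4 => dir) k).quasiMeasurePreserving.ae
    dirichlet_ae_simplex

theorem integrable_fourDirichlet {g : (Fin 4 → Fin 3 → ℝ) → ℝ} (hg : Continuous g) :
    Integrable g fourDirichlet := by
  obtain ⟨C, hC⟩ := isCompact_Icc.exists_bound_of_continuousOn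
    (s := Set.Icc (0 : Fin 4 → Fin 3 → ℝ) 1) hg.continuousOn
  refine Integrable.of_bound hg.aestronglyMeasurable C ?_
  filter_upwards [fourDirichlet_ae_simplex] with v hv
  refine hC v ⟨fun k i => (hv k).1 i, fun k i => ?_⟩
  rw [Pi.one_apply, Pi.one_apply, ← (hv k).2]
  exact Finset.single_le_sum (fun j _ => (hv k).1 j) (Finset.mem_univ i)

/-- The mean of `H` over the sizes of the nine branches two levels below the root of a tree of size
`m`, if the branches are chosen independently with the distributions `v`. -/
def indepGsplit (v : Fin 4 → Fin 3 → ℝ) (m : ℕ) (H : (Fin 3 → Fin 3 → ℕ) → ℝ) : ℝ :=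
  indepSplit (v 0) m fun a => indepSplit (v 1) (a 0) fun b₀ => indepSplit (v 2) (a 1) fun b₁ =>
    indepSplit (v 3) (a 2) fun b₂ => H ![b₀, b₁, b₂]

/-- After expansion into finite sums every term is a product of functions of the four separate
vectors, and the product measure factorizes its integral. -/
theorem law_gsize_eq_integral (m : ℕ) (H : (Fin 3 → Fin 3 → ℕ) → ℝ) :
    TTree.law m (fun T => H T.gsize) = ∫ v, indepGsplit v m H ∂fourDirichlet := by
  have hc : ∀ (k : Fin 4) (s : ℕ) (b : Fin 3 → ℕ),
      Continuous fun v : Fin 4 → Fin 3 → ℝ => splitWeight (v k) s b :=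
    fun k s b => (continuous_splitWeight s _).comp (continuous_apply k)
  have hterm : ∀ (s₀ s₁ s₂ s₃ : ℕ) (c₀ c₁ c₂ c₃ : Fin 3 → ℕ) (z : ℝ),
      ∫ v, splitWeight (v 0) s₀ c₀ * (splitWeight (v 1) s₁ c₁ *
        (splitWeight (v 2) s₂ c₂ * (splitWeight (v 3) s₃ c₃ * z)))
          ∂fourDirichlet =
      (∫ v, splitWeight v s₀ c₀ ∂dir) *
        ((∫ v, splitWeight v s₁ c₁ ∂dir) *
          ((∫ v, splitWeight v s₂ c₂ ∂dir) *
            ((∫ v, splitWeight v s₃ c₃ ∂dir) * z))) := by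
    intro s₀ s₁ s₂ s₃ c₀ c₁ c₂ c₃ z
    have h := integral_fintype_prod_eq_prod (μ := fun _ : Fin 4 => dir)
      (fun k x => splitWeight x (![s₀, s₁, s₂, s₃] k) (![c₀, c₁, c₂, c₃] k))
    simp only [Fin.prod_univ_four, Matrix.cons_val] at h
    simp only [← mul_assoc]
    rw [integral_mul_const]
    exact congrArg (· * z) h
  rw [TTree.law_gsize]
  simp only [indepGsplit, split_eq_sum, indepSplit_eq_sum, Finset.mul_sum]
  rw [integral_finsetSum]
  swap
  · intro a _
    refine integrable_fourDirichlet ?_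
    fun_prop
  refine Finset.sum_congr rfl fun a _ => ?_
  rw [integral_finsetSum]
  swap
  · intro b₀ _
    refine integrable_fourDirichlet ?_
    fun_prop
  refine Finset.sum_congr rfl fun b₀ _ => ?_
  rw [integral_finsetSum]
  swap
  · intro b₁ _
    refine integrable_fourDirichlet ?_
    fun_prop
  refine Finset.sum_congr rfl fun b₁ _ => ?_
  rw [integral_finsetSum]
  swap
  · intro b₂ _
    refine integrable_fourDirichlet ?_
    fun_prop
  refine Finset.sum_congr rfl fun b₂ _ => ?_
  exact (hterm _ _ _ _ _ _ _ _ _).symm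

/-! ### Concentration of the branch sizes -/

theorem indepSplit_add (x : Fin 3 → ℝ) (s : ℕ) (g h : (Fin 3 → ℕ) → ℝ) :
    indepSplit x s (fun b => g b + h b) = indepSplit x s g + indepSplit x s h :=
  draw_iterate_add _ _ _ _ _

theorem indepSplit_mul_const (x : Fin 3 → ℝ) (s : ℕ) (c : ℝ) (g : (Fin 3 → ℕ) → ℝ) :
    indepSplit x s (fun b => g b * c) = indepSplit x s g * c :=
  draw_iterate_mul_const _ _ _ _ _

theorem indepSplit_sum {ι : Type*} (t : Finset ι) (x : Fin 3 → ℝ) (s : ℕ)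
    (g : ι → (Fin 3 → ℕ) → ℝ) :
    indepSplit x s (fun b => ∑ i ∈ t, g i b) = ∑ i ∈ t, indepSplit x s (g i) :=
  draw_iterate_sum _ _ _ _ _

theorem indepSplit_const {x : Fin 3 → ℝ} (hx : ∑ i, x i = 1) (s : ℕ) (c : ℝ) :
    indepSplit x s (fun _ => c) = c :=
  draw_iterate_const hx _ _ _

theorem indepSplit_mono {x : Fin 3 → ℝ} (hx : ∀ i, 0 ≤ x i) {s : ℕ} {g h : (Fin 3 → ℕ) → ℝ}
    (H : ∀ b, ∑ i, b i ≤ s → g b ≤ h b) : indepSplit x s g ≤ indepSplit x s h := by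
  refine draw_iterate_mono hx fun b hb => H b ?_
  simp only [Pi.zero_apply, Finset.sum_const_zero] at hb
  omega

theorem le_one_of_simplex {x : Fin 3 → ℝ} (hx : (∀ i, 0 ≤ x i) ∧ ∑ i, x i = 1) (j : Fin 3) :
    x j ≤ 1 := by
  rw [← hx.2]
  exact Finset.single_le_sum (fun i _ => hx.1 i) (Finset.mem_univ j)

/-- The factor `2` and the summand `2` pay for having `s - 1` draws instead of `s`; the variance is
at most the number of draws. -/
theorem indepSplit_sq_le {x : Fin 3 → ℝ} (hx : (∀ i, 0 ≤ x i) ∧ ∑ i, x i = 1) (s : ℕ)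
    (j : Fin 3) (z : ℝ) :
    indepSplit x s (fun b => ((b j : ℝ) - z) ^ 2) ≤ 2 * (s * x j - z) ^ 2 + s + 2 := by
  have h0 := hx.1 j
  have h1 := le_one_of_simplex hx j
  rw [indepSplit, draw_iterate_sq hx.2]
  cases s with
  | zero =>
    simp only [zero_le, Nat.sub_eq_zero_of_le, Nat.cast_zero, Pi.zero_apply]
    nlinarith [sq_nonneg z]
  | succ m =>
    have hm : (0 : ℝ) ≤ m := Nat.cast_nonneg m
    simp only [Nat.add_sub_cancel, Pi.zero_apply, Nat.cast_zero, zero_add]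
    push_cast
    have h2 : (m * x j - z) ^ 2 ≤ 2 * ((m + 1) * x j - z) ^ 2 + 2 * x j ^ 2 := by
      nlinarith [sq_nonneg ((m + 1) * x j - z + x j)]
    have h3 : (m : ℝ) * (x j * (1 - x j)) ≤ m * 1 :=
      mul_le_mul_of_nonneg_left (by nlinarith) hm
    nlinarith

/-- Compare `b j` with `a i * y j` and then `a i` with `m * x i`: the outer error enters twice and
the inner once, giving `3 * (m + 2)`. -/
theorem indepSplit_indepSplit_sq_le {x y : Fin 3 → ℝ} (hx : (∀ i, 0 ≤ x i) ∧ ∑ i, x i = 1)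
    (hy : (∀ i, 0 ≤ y i) ∧ ∑ i, y i = 1) (m : ℕ) (i j : Fin 3) :
    indepSplit x m (fun a => indepSplit y (a i) fun b => ((b j : ℝ) - m * (x i * y j)) ^ 2) ≤
      3 * m + 6 := by
  have h0 := hy.1 j
  have h1 := le_one_of_simplex hy j
  have step : indepSplit x m (fun a => indepSplit y (a i) fun b =>
      ((b j : ℝ) - m * (x i * y j)) ^ 2) ≤
      indepSplit x m (fun a => ((a i : ℝ) - m * x i) ^ 2 * 2 + (m + 2)) := by
    refine indepSplit_mono hx.1 fun a ha => (indepSplit_sq_le hy _ j _).trans ?_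
    have h2 : (a i : ℝ) ≤ m := by
      exact_mod_cast (Finset.single_le_sum (f := a) (fun k _ => Nat.zero_le _)
        (Finset.mem_univ i)).trans ha
    have h3 : ((a i : ℝ) * y j - m * (x i * y j)) ^ 2 ≤ (a i - m * x i) ^ 2 := by
      rw [show (a i : ℝ) * y j - m * (x i * y j) = (a i - m * x i) * y j by ring, mul_pow]
      exact mul_le_of_le_one_right (sq_nonneg _) (pow_le_one₀ h0 h1)
    linarith
  refine step.trans ?_
  rw [indepSplit_add, indepSplit_mul_const, indepSplit_const hx.2]
  have := indepSplit_sq_le hx m i (m * x i)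
  rw [sub_self] at this
  linarith

theorem indepGsplit_sq_le {v : Fin 4 → Fin 3 → ℝ}
    (hv : ∀ k, (∀ i, 0 ≤ v k i) ∧ ∑ i, v k i = 1) (m : ℕ) (i j : Fin 3) :
    indepGsplit v m (fun b => ((b i j : ℝ) - m * (v 0 i * v i.succ j)) ^ 2) ≤ 3 * m + 6 := by
  unfold indepGsplit
  fin_cases i
  · simpa [indepSplit_const (hv _).2] using indepSplit_indepSplit_sq_le (hv 0) (hv 1) m 0 j
  · simpa [indepSplit_const (hv _).2] using indepSplit_indepSplit_sq_le (hv 0) (hv 2) m 1 j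
  · simpa [indepSplit_const (hv _).2] using indepSplit_indepSplit_sq_le (hv 0) (hv 3) m 2 j

theorem indepGsplit_mono {v : Fin 4 → Fin 3 → ℝ} (hv : ∀ k, ∀ i, 0 ≤ v k i) (m : ℕ)
    {H H' : (Fin 3 → Fin 3 → ℕ) → ℝ} (h : ∀ b, H b ≤ H' b) :
    indepGsplit v m H ≤ indepGsplit v m H' :=
  indepSplit_mono (hv 0) fun _ _ => indepSplit_mono (hv 1) fun _ _ =>
    indepSplit_mono (hv 2) fun _ _ => indepSplit_mono (hv 3) fun _ _ => h _

theorem indepGsplit_const {v : Fin 4 → Fin 3 → ℝ} (hv : ∀ k, ∑ i, v k i = 1) (m : ℕ) (c : ℝ) :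
    indepGsplit v m (fun _ => c) = c := by
  simp [indepGsplit, indepSplit_const (hv _)]

/-! ### Comparison of the ratio with `1 - Υ`. -/

theorem continuous_upsilon : Continuous upsilon := by
  unfold upsilon
  refine Continuous.finset_inf'_apply _ fun p _ => ?_
  fun_prop

theorem upsilon_le (v : Fin 4 → Fin 3 → ℝ) (i k j : Fin 3) :
    upsilon v ≤ v 0 i * v k.succ j :=
  Finset.inf'_le (fun p : Fin 3 × Fin 3 × Fin 3 => v 0 p.1 * v p.2.1.succ p.2.2)
    (Finset.mem_univ (i, k, j))

theorem upsilon_nonneg {v : Fin 4 → Fin 3 → ℝ} (hv : ∀ k, ∀ i, 0 ≤ v k i) : 0 ≤ upsilon v :=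
  Finset.le_inf' _ _ fun _ _ => mul_nonneg (hv _ _) (hv _ _)

/-- Uniform continuity of the power on `[0, 2]`, which treats exponents below and above `1` alike.
-/
theorem exists_rpow_add_le {lam ε : ℝ} (hlam : 0 < lam) (hε : 0 < ε) :
    ∃ δ > 0, ∀ s ∈ Set.Icc (0 : ℝ) 1, (s + δ) ^ lam ≤ s ^ lam + ε := by
  have huc : UniformContinuousOn (fun s : ℝ => s ^ lam) (Set.Icc 0 2) :=
    isCompact_Icc.uniformContinuousOn_of_continuous
      (Real.continuous_rpow_const hlam.le).continuousOn
  obtain ⟨δ, hδ, h⟩ := Metric.uniformContinuousOn_iff.1 huc ε hε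
  refine ⟨min (δ / 2) 1, by positivity, fun s hs => ?_⟩
  have h1 : min (δ / 2) 1 ≤ 1 := min_le_right _ _
  have h2 : min (δ / 2) 1 ≤ δ / 2 := min_le_left _ _
  have h3 : 0 < min (δ / 2) 1 := by positivity
  have := h (s + min (δ / 2) 1) ⟨by linarith [hs.1], by linarith [hs.2]⟩ s
    ⟨hs.1, by linarith [hs.2]⟩ (by
      rw [Real.dist_eq, add_sub_cancel_left, abs_of_pos h3]; linarith)
  rw [Real.dist_eq] at this
  linarith [(abs_lt.1 this).2]

/-- Chebyshev in pointwise form. Either no size falls short of its predicted value by more than `δ *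
m`, and the ratio is at most `1 - Υ + δ`; or one does, and its normalized squared deviation exceeds
`1`, which bounds the left side. Only nine of the 27 products in `Υ` are branch shares; the minimum
over all of them is a lower bound. -/
theorem rpow_share_le {lam ε δ : ℝ} (hlam : 0 < lam) (hε : 0 < ε) (hδ : 0 < δ)
    (hδε : ∀ s ∈ Set.Icc (0 : ℝ) 1, (s + δ) ^ lam ≤ s ^ lam + ε) {v : Fin 4 → Fin 3 → ℝ}
    (hv : ∀ k, (∀ i, 0 ≤ v k i) ∧ ∑ i, v k i = 1) {m : ℕ} (hm : 0 < m)
    (b : Fin 3 → Fin 3 → ℕ) :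
    max (((m : ℝ) - TTree.minEntry b) / m) 0 ^ lam ≤ ((1 - upsilon v) ^ lam + ε) +
      ∑ p : Fin 3 × Fin 3, ((b p.1 p.2 : ℝ) - m * (v 0 p.1 * v p.1.succ p.2)) ^ 2 *
        ((δ * m) ^ 2)⁻¹ := by
  have hm' : (0 : ℝ) < m := Nat.cast_pos.2 hm
  have hu0 : 0 ≤ upsilon v := upsilon_nonneg fun k => (hv k).1
  have hu1 : upsilon v ≤ 1 := (upsilon_le v 0 0 0).trans
    (mul_le_one₀ (le_one_of_simplex (hv 0) 0) ((hv _).1 _) (le_one_of_simplex (hv _) _))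
  have hs0 : ∀ p : Fin 3 × Fin 3,
      0 ≤ ((b p.1 p.2 : ℝ) - m * (v 0 p.1 * v p.1.succ p.2)) ^ 2 * ((δ * m) ^ 2)⁻¹ :=
    fun p => by positivity
  have hR0 : (0 : ℝ) ≤ (1 - upsilon v) ^ lam := Real.rpow_nonneg (by linarith) _
  by_cases hb : ∀ p : Fin 3 × Fin 3,
      m * (v 0 p.1 * v p.1.succ p.2) - δ * m ≤ (b p.1 p.2 : ℝ)
  · obtain ⟨p, -, hp⟩ := Finset.exists_mem_eq_inf' (s := (Finset.univ : Finset (Fin 3 × Fin 3)))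
      Finset.univ_nonempty fun p => b p.1 p.2
    have hmin : ((TTree.minEntry b : ℕ) : ℝ) = b p.1 p.2 := congrArg Nat.cast hp
    have h1 : max (((m : ℝ) - TTree.minEntry b) / m) 0 ≤ (1 - upsilon v) + δ := by
      refine max_le ?_ (by linarith)
      rw [div_le_iff₀ hm', hmin]
      have := hb p
      have h2 := mul_le_mul_of_nonneg_left (upsilon_le v p.1 p.1 p.2) hm'.le
      nlinarith
    refine (Real.rpow_le_rpow (le_max_right _ _) h1 hlam.le).trans
      ((hδε _ ⟨by linarith, by linarith⟩).trans ?_)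
    exact le_add_of_nonneg_right (Finset.sum_nonneg fun p _ => hs0 p)
  · obtain ⟨p, hp⟩ := not_forall.1 hb
    have h1 : max (((m : ℝ) - TTree.minEntry b) / m) 0 ^ lam ≤ 1 := by
      refine Real.rpow_le_one (le_max_right _ _) (max_le ?_ zero_le_one) hlam.le
      rw [div_le_one hm']
      linarith [(Nat.cast_nonneg (TTree.minEntry b) : (0 : ℝ) ≤ _)]
    have h2 : 1 ≤ ((b p.1 p.2 : ℝ) - m * (v 0 p.1 * v p.1.succ p.2)) ^ 2 * ((δ * m) ^ 2)⁻¹ := by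
      rw [← div_eq_mul_inv, one_le_div (by positivity), sq_le_sq, abs_of_pos (by positivity)]
      refine le_trans ?_ (neg_le_abs _)
      linarith
    have h3 := Finset.single_le_sum (fun p _ => hs0 p) (Finset.mem_univ p)
    linarith

theorem exists_law_ratio_le {lam θ : ℝ} (hlam : 0 < lam)
    (hθ : ∫ v, (1 - upsilon v) ^ lam ∂fourDirichlet < θ) :
    ∃ L : ℕ, 1 ≤ L ∧ ∀ m, L ≤ m → TTree.law m (fun T => T.ratio ^ lam) ≤ θ := by
  set I := ∫ v, (1 - upsilon v) ^ lam ∂fourDirichlet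
  set ε := (θ - I) / 2 with hεdef
  have hε : 0 < ε := by rw [hεdef]; linarith
  obtain ⟨δ, hδ, hδε⟩ := exists_rpow_add_le hlam hε
  -- The nine squared deviations contribute `9 * (3 * m + 6) / (δ * m) ^ 2 ≤ 81 / (δ ^ 2 * m)`,
  -- which is at most `ε` from here on.
  refine ⟨⌈81 / (ε * δ ^ 2)⌉₊ + 1, by omega, fun m hm => ?_⟩
  have hm1 : 1 ≤ m := by omega
  have hm' : (1 : ℝ) ≤ m := by exact_mod_cast hm1
  have hmε : 81 ≤ m * (ε * δ ^ 2) := by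
    rw [← div_le_iff₀ (by positivity)]
    exact (Nat.le_ceil _).trans (by exact_mod_cast (Nat.le_succ _).trans hm)
  set H : (Fin 3 → Fin 3 → ℕ) → ℝ := fun b =>
    max (((m : ℝ) - TTree.minEntry b) / m) 0 ^ lam with hH
  have h1 : TTree.law m (fun T => T.ratio ^ lam) = TTree.law m fun T => H T.gsize := by
    refine TTree.law_congr fun T hT => ?_
    have h0 := T.ratio_nonneg
    rw [TTree.ratio, hT] at h0
    simp only [hH, TTree.ratio, hT, max_eq_left h0]
  have hcont : Continuous fun v => (1 - upsilon v) ^ lam :=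
    (continuous_const.sub continuous_upsilon).rpow_const fun _ => .inr hlam.le
  have h2 : ∫ v, indepGsplit v m H ∂fourDirichlet ≤
      ∫ v, ((1 - upsilon v) ^ lam + (ε + ε)) ∂fourDirichlet := by
    refine integral_mono_of_nonneg ?_ (integrable_fourDirichlet (hcont.add continuous_const)) ?_
    · filter_upwards [fourDirichlet_ae_simplex] with v hv
      rw [Pi.zero_apply, ← indepGsplit_const (fun k => (hv k).2) m 0]
      exact indepGsplit_mono (fun k => (hv k).1) m fun b => Real.rpow_nonneg (le_max_right _ _) _
    · filter_upwards [fourDirichlet_ae_simplex] with v hv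
      refine (indepGsplit_mono (fun k => (hv k).1) m
        fun b => rpow_share_le hlam hε hδ hδε hv hm1 b).trans ?_
      have hadd : indepGsplit v m (fun b => ((1 - upsilon v) ^ lam + ε) +
          ∑ p : Fin 3 × Fin 3, ((b p.1 p.2 : ℝ) - m * (v 0 p.1 * v p.1.succ p.2)) ^ 2 *
            ((δ * m) ^ 2)⁻¹) = ((1 - upsilon v) ^ lam + ε) +
          ∑ p : Fin 3 × Fin 3, indepGsplit v m (fun b =>
            ((b p.1 p.2 : ℝ) - m * (v 0 p.1 * v p.1.succ p.2)) ^ 2) * ((δ * m) ^ 2)⁻¹ := by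
        simp only [indepGsplit, indepSplit_add, indepSplit_sum, indepSplit_mul_const,
          indepSplit_const (hv _).2]
      rw [hadd, add_assoc]
      refine add_le_add_right (add_le_add_right ?_ ε) _
      have hsum : ∑ p : Fin 3 × Fin 3, indepGsplit v m (fun b =>
            ((b p.1 p.2 : ℝ) - m * (v 0 p.1 * v p.1.succ p.2)) ^ 2) * ((δ * m) ^ 2)⁻¹ ≤
          ∑ _p : Fin 3 × Fin 3, (3 * (m : ℝ) + 6) * ((δ * m) ^ 2)⁻¹ :=
        Finset.sum_le_sum fun p _ => mul_le_mul_of_nonneg_right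
          (indepGsplit_sq_le hv m p.1 p.2) (by positivity)
      refine hsum.trans ?_
      rw [Finset.sum_const, Finset.card_univ]
      simp only [Fintype.card_prod, Fintype.card_fin, nsmul_eq_mul]
      push_cast
      rw [← div_eq_mul_inv, mul_div_assoc', div_le_iff₀ (by positivity), mul_pow]
      nlinarith
  rw [h1, law_gsize_eq_integral]
  refine h2.trans ?_
  rw [integral_add (integrable_fourDirichlet hcont) (integrable_const _), integral_const]
  simp only [probReal_univ, one_smul]
  rw [hεdef]
  apply le_of_eq
  change I + _ = θ
  ring

/-! ### The almost sure bound -/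

/-- Markov's inequality for the `lam`-th power. -/
theorem law_potential_gt_le {κ lam θ : ℝ} (hκ : 0 < κ) (hlam : 0 < lam) {L : ℕ}
    (hθ : ∀ m, L ≤ m → TTree.law m (fun T => T.ratio ^ lam) ≤ θ) (k m : ℕ) :
    TTree.law m ({T | (κ ^ k)⁻¹ < TTree.potential L k T}.indicator fun _ => 1) ≤
      (9 * κ ^ lam * θ) ^ k := by
  have h1 : TTree.law m ({T | (κ ^ k)⁻¹ < TTree.potential L k T}.indicator fun _ => 1) ≤
      TTree.law m fun T => TTree.potential L k T ^ lam * (κ ^ lam) ^ k := by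
    refine TTree.law_mono fun T _ => ?_
    have h0 := TTree.potential_nonneg L k T
    have hpow : TTree.potential L k T ^ lam * (κ ^ lam) ^ k =
        (TTree.potential L k T * κ ^ k) ^ lam := by
      rw [Real.mul_rpow h0 (by positivity), ← Real.rpow_natCast, ← Real.rpow_natCast,
        ← Real.rpow_mul hκ.le, ← Real.rpow_mul hκ.le, mul_comm lam]
    rw [hpow]
    by_cases hT : T ∈ {T | (κ ^ k)⁻¹ < TTree.potential L k T}
    · rw [Set.indicator_of_mem hT]
      refine Real.one_le_rpow ?_ hlam.le
      have : (κ ^ k)⁻¹ < TTree.potential L k T := hT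
      rw [inv_lt_iff_one_lt_mul₀ (by positivity)] at this
      linarith
    · rw [Set.indicator_of_notMem hT]
      exact Real.rpow_nonneg (by positivity) _
  refine h1.trans ?_
  rw [TTree.law_mul_const, show (9 * κ ^ lam * θ) ^ k = (9 * θ) ^ k * (κ ^ lam) ^ k by
    rw [← mul_pow]; ring]
  exact mul_le_mul_of_nonneg_right (TTree.law_potential_le hlam hθ k m) (by positivity)

/-- Borel–Cantelli with a geometric series. The tail bound does not depend on the size of the tree,
so the observation times `N` are free; admissibility comes along because its failure is part of the
bad event. -/
theorem IsRandomApollonianNetwork.ae_eventually_potential_le {Ω : Type*} [MeasurableSpace Ω]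
    {P : Measure Ω} [IsProbabilityMeasure P] {F : ℕ → Ω → Finset ℕ}
    (hF : IsRandomApollonianNetwork P F) {κ lam θ : ℝ} (hκ : 0 < κ) (hlam : 0 < lam) {L : ℕ}
    (hθ : ∀ m, L ≤ m → TTree.law m (fun T => T.ratio ^ lam) ≤ θ)
    (hq : 9 * κ ^ lam * θ < 1) (N : ℕ → ℕ) :
    ∀ᵐ ω ∂P, ∀ᶠ k in atTop, Valid (fun s => F s ω) (N k) ∧
      TTree.potential L k (ltree (fun s => F s ω) (N k)).shape ≤ (κ ^ k)⁻¹ := by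
  have hθ0 : 0 ≤ θ :=
    (TTree.law_nonneg fun T _ => Real.rpow_nonneg T.ratio_nonneg _).trans (hθ L le_rfl)
  set q := 9 * κ ^ lam * θ
  have hq0 : 0 ≤ q := by positivity
  have hle : ∀ k, P {ω | Valid (fun s => F s ω) (N k) → (ltree (fun s => F s ω) (N k)).shape ∈
      {T | (κ ^ k)⁻¹ < TTree.potential L k T}} ≤ ENNReal.ofReal (q ^ k) := fun k =>
    (hF.measure_shape_le _ (N k)).trans
      (ENNReal.ofReal_le_ofReal (law_potential_gt_le hκ hlam hθ k (N k)))
  have hsum : ∑' k, P {ω | Valid (fun s => F s ω) (N k) →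
      (ltree (fun s => F s ω) (N k)).shape ∈
      {T | (κ ^ k)⁻¹ < TTree.potential L k T}} ≠ ⊤ := by
    refine ne_top_of_le_ne_top ?_ (ENNReal.tsum_le_tsum hle)
    rw [← ENNReal.ofReal_tsum_of_nonneg (fun k => pow_nonneg hq0 k)
      (summable_geometric_of_lt_one hq0 hq)]
    exact ENNReal.ofReal_ne_top
  filter_upwards [ae_eventually_notMem hsum] with ω hω
  filter_upwards [hω] with k hk
  have hk' : ¬(Valid (fun s => F s ω) (N k) →
      (κ ^ k)⁻¹ < TTree.potential L k (ltree (fun s => F s ω) (N k)).shape) := hk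
  exact ⟨(Classical.not_imp.1 hk').1, not_lt.1 (Classical.not_imp.1 hk').2⟩

end

end RAN

theorem theorem4 (τ κ lam : ℝ) (hτ : 1 < τ) (hκ : 0 < κ) (hlam : 0 < lam)
    (h₁ : 3 * Real.exp 1 * Real.log τ < 2 * Real.sqrt τ)
    (h₂ : 9 * κ ^ lam * (∫ v, (1 - RAN.upsilon v) ^ lam ∂(RAN.fourDirichlet)) < 1) :
    ∃ K : ℝ, ∀ (Ω : Type*) [MeasurableSpace Ω] (P : Measure Ω) [IsProbabilityMeasure P]
      (F : ℕ → Ω → Finset ℕ), RAN.IsRandomApollonianNetwork P F →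
      ∀ᵐ ω ∂P, ∀ᶠ t : ℕ in atTop, ∀ n : ℤ,
        IsGreatest {m : ℤ | Even m ∧ (m : ℝ) < Real.log t / Real.log τ} n →
        ∀ J : Finset (Finset ℕ), RAN.IsBuonoSubtree (fun s => F s ω) t J →
          (J.card : ℝ) ≤ K * ((8 : ℝ) ^ ((n : ℝ) / 2) + (t : ℝ) * κ ^ (-((n : ℝ) / 2))) := by
  have hc : 0 < 9 * κ ^ lam := by positivity
  -- Strictness in `h₂` leaves room for a `θ` above the limiting moment.
  obtain ⟨θ, hθI, hθ1⟩ := exists_between ((lt_div_iff₀' hc).2 h₂)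
  obtain ⟨L, hL, hLθ⟩ := RAN.exists_law_ratio_le hlam hθI
  have hτ0 : 0 < τ := by linarith
  have hlog : 0 < Real.log τ := Real.log_pos hτ
  -- The first summand serves the term `8 ^ k`; the second comes from the size of the tree at the
  -- end of the block, at most `(τ ^ 2 + 1) * t`.
  refine ⟨(3 * L + 2) + 3 * (τ ^ 2 + 1), fun Ω _ P _ F hF => ?_⟩
  filter_upwards [hF.ae_eventually_potential_le hκ hlam hLθ ((lt_div_iff₀' hc).1 hθ1)
    fun k => ⌈τ ^ (2 * k + 2)⌉₊] with ω hω
  obtain ⟨k₀, hk₀⟩ := eventually_atTop.1 hω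
  filter_upwards [eventually_gt_atTop ⌈τ ^ (2 * k₀ + 2)⌉₊] with t ht n hn J hJ
  have ht' : τ ^ (2 * k₀ + 2) < (t : ℝ) := Nat.lt_of_ceil_lt ht
  have ht1 : (1 : ℝ) ≤ t := (one_le_pow₀ hτ.le).trans ht'.le
  have htpos : (0 : ℝ) < t := by linarith
  have hnt : (n : ℝ) * Real.log τ < Real.log t := (lt_div_iff₀ hlog).1 hn.1.2
  -- Maximality of `n` among even integers: `n + 2` is no longer admissible.
  have htn : Real.log t ≤ ((n : ℝ) + 2) * Real.log τ := by
    by_contra! hcon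
    have : n + 2 ≤ n := hn.2 ⟨hn.1.1.add even_two, by
      rw [lt_div_iff₀ hlog]
      push_cast
      exact hcon⟩
    omega
  obtain ⟨k, hk, rfl⟩ : ∃ k : ℕ, k₀ ≤ k ∧ n = 2 * (k : ℤ) := by
    obtain ⟨r, hr⟩ := hn.1.1
    have h1 := Real.log_lt_log (by positivity) ht'
    rw [Real.log_pow] at h1
    have h2 := lt_of_mul_lt_mul_right (h1.trans_le htn) hlog.le
    have h3 : ((2 * k₀ + 2 : ℕ) : ℤ) < n + 2 := by exact_mod_cast h2
    refine ⟨r.toNat, ?_, ?_⟩ <;> push_cast at h3 <;> omega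
  have hpow : ∀ j : ℕ, Real.log (τ ^ j) = j * Real.log τ := fun j => Real.log_pow τ j
  have htN : t ≤ ⌈τ ^ (2 * k + 2)⌉₊ := by
    have : (t : ℝ) ≤ τ ^ (2 * k + 2) := by
      rw [← Real.log_le_log_iff htpos (by positivity), hpow]
      push_cast at htn ⊢
      exact htn
    exact_mod_cast this.trans (Nat.le_ceil _)
  have hkt : τ ^ (2 * k) < t := by
    rw [← Real.log_lt_log_iff (by positivity) htpos, hpow]
    push_cast at hnt ⊢
    exact hnt
  have hNt : (⌈τ ^ (2 * k + 2)⌉₊ : ℝ) ≤ (τ ^ 2 + 1) * t := by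
    have := (Nat.ceil_lt_add_one (show 0 ≤ τ ^ (2 * k + 2) by positivity)).le
    have hp : τ ^ (2 * k + 2) = τ ^ (2 * k) * τ ^ 2 := pow_add _ _ _
    have := mul_le_mul_of_nonneg_right hkt.le (sq_nonneg τ)
    linarith
  obtain ⟨hvalid, hpot⟩ := hk₀ k hk
  -- `J` is regarded as a subtree at the end of the block, where the potential is controlled.
  have hcard := (hJ.mono hvalid htN).card_le hvalid hL k
  rw [RAN.size_ltree hvalid] at hcard
  have e1 : (((2 * (k : ℤ) : ℤ) : ℝ) / 2) = k := by push_cast; ring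
  rw [e1, Real.rpow_neg hκ.le, Real.rpow_natCast, Real.rpow_natCast]
  have hκk : 0 < (κ ^ k)⁻¹ := by positivity
  have h3 : (⌈τ ^ (2 * k + 2)⌉₊ : ℝ) *
      RAN.TTree.potential L k (RAN.ltree (fun s => F s ω) ⌈τ ^ (2 * k + 2)⌉₊).shape ≤
      (τ ^ 2 + 1) * t * (κ ^ k)⁻¹ :=
    mul_le_mul hNt hpot (RAN.TTree.potential_nonneg _ _ _) (by positivity)
  have h4 : 0 ≤ (3 * (L : ℝ) + 2) * (t * (κ ^ k)⁻¹) := by positivity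
  have h5 : 0 ≤ 3 * (τ ^ 2 + 1) * (8 : ℝ) ^ k := by positivity
  linarith
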